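/- Let $G$ be a group. A family of subgroups $\mathfrak F$ of $G$ is a collection of subgroups closed under conjugation and under taking subgroups. The orbit category $\mathcal O_{\mathfrak F}G$ has as objects the $G$-sets $G/H$ with $H\in\mathfrak F$, and as morphisms the $G$-maps; $\mathrm{Mod}_{\mathfrak F}G$ is the category of contravariant functors $\mathcal O_{\mathfrak F}G\to\mathfrak{Ab}$. For $M\in\mathrm{Mod}_{\mathfrak F}G$ the Bredon cohomology is $H^n_{\mathfrak F}(G,M)=\mathrm{Ext}^n_{\mathrm{Mod}_{\mathfrak F}G}(\underline{\mathbb Z},M)$, where $\underline{\mathbb Z}$ is the constant functor. For a subgroup $S\le G$ put $\mathfrak F\cap S=\{H\cap S\mid H\in\mathfrak F\}$, and let $\mathrm{Res}^G_S:\mathrm{Mod}_{\mathfrak F}G\to\mathrm{Mod}_{\mathfrak F\cap S}S$ be composition with the functor $S/H\mapsto G/H$; as $\mathrm{Res}^G_S$ is exact and carries $\underline{\mathbb Z}$ to $\underline{\mathbb Z}$, it induces restriction maps $H^n_{\mathfrak F}(G,M)\to H^n_{\mathfrak F\cap S}(S,\mathrm{Res}^G_SM)$. Let $G=A\ast_C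 B$ be an amalgamated product of groups along injective homomorphisms $C\to A$ and $C\to B$, and regard $A$, $B$, $C$ as subgroups of $G$. Let $\mathfrak F$ be a family of subgroups of $G$ such that every $F\in\mathfrak F$ is contained in a conjugate of $A$ or in a conjugate of $B$. Then for every $M\in\mathrm{Mod}_{\mathfrak F}G$ there is a long exact sequence $$0\to H^0_{\mathfrak F}(G,M)\to\cdots\to H^{i}_{\mathfrak F}(G,M)\xrightarrow{\alpha_i} H^i_{\mathfrak F\cap A}(A,\mathrm{Res}^G_AM)\oplus H^i_{\mathfrak F\cap B}(B,\mathrm{Res}^G_BM)\xrightarrow{\beta_i} H^i_{\mathfrak F\cap C}(C,\mathrm{Res}^G_CM)\xrightarrow{\delta_i} H^{i+1}_{\mathfrak F}(G,M)\to\cdots$$ in which $\alpha_i$ is given by the two restriction maps and $\beta_i$ is the difference of the restriction maps from $A$ to $C$ and from $B$ to $C$. -/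

import Mathlib

open CategoryTheory

universe u

noncomputable section

/-- A family of subgroups of `G`: a collection of subgroups of `G` which is closed under
conjugation by elements of `G` and under passing to subgroups. -/
structure SubgroupFamily (G : Type u) [Group G] where
  carrier : Set (Subgroup G)
  conj_mem : ∀ H ∈ carrier, ∀ g : G, H.map (MulAut.conj g).toMonoidHom ∈ carrier
  of_le : ∀ H ∈ carrier, ∀ K : Subgroup G, K ≤ H → K ∈ carrier

instance {G : Type u} [Group G] : Membership (Subgroup G) (SubgroupFamily G) where
  mem F H := H ∈ F.carrier

/-- The family `F ∩ S` of subgroups of `S`, for a homomorphism `f : S → G`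
(typically injective, and used to regard `S` as a subgroup of `G`): it consists of the
subgroups `K` of `S` whose image in `G` belongs to `F`. -/
def SubgroupFamily.restrict {S G : Type u} [Group S] [Group G] (F : SubgroupFamily G)
    (f : S →* G) : SubgroupFamily S where
  carrier := {K | K.map f ∈ F}
  conj_mem K hK s := by
    have h := F.conj_mem _ hK (f s)
    have e : (K.map f).map (MulAut.conj (f s)).toMonoidHom
        = (K.map (MulAut.conj s).toMonoidHom).map f := by
      rw [Subgroup.map_map, Subgroup.map_map]
      congr 1
      ext x
      simp
    rw [e] at h
    exact h
  of_le K hK L hL := F.of_le _ hK _ (Subgroup.map_mono hL)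

/-- For injective `f`, `F.restrict f` consists of the intersections (preimages under `f`) of
the members of `F` with `S`. -/
theorem SubgroupFamily.mem_restrict_iff {S G : Type u} [Group S] [Group G]
    (F : SubgroupFamily G) (f : S →* G) (hf : Function.Injective f) (K : Subgroup S) :
    K ∈ F.restrict f ↔ ∃ H ∈ F, K = H.comap f := by
  constructor
  · intro h
    exact ⟨K.map f, h, (Subgroup.comap_map_eq_self_of_injective hf K).symm⟩
  · rintro ⟨H, hH, rfl⟩
    exact F.of_le H hH _ (Subgroup.map_comap_le f H)

/-- For a subgroup `S` of `G`, `F.restrict S.subtype` is `F ∩ S = {H ∩ S | H ∈ F}`. -/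
theorem SubgroupFamily.mem_restrict_subtype_iff {G : Type u} [Group G]
    (F : SubgroupFamily G) (S : Subgroup G) (K : Subgroup S) :
    K ∈ F.restrict S.subtype ↔ ∃ H ∈ F, K = H.subgroupOf S :=
  F.mem_restrict_iff S.subtype S.subtype_injective K

theorem SubgroupFamily.map_mem {S G : Type u} [Group S] [Group G] (F : SubgroupFamily G)
    (f : S →* G) : ∀ K ∈ F.restrict f, K.map f ∈ F := fun _ hK => hK

theorem SubgroupFamily.map_mem_restrict {S T G : Type u} [Group S] [Group T] [Group G]
    (F : SubgroupFamily G) (j : S →* T) (g : T →* G) (f : S →* G) (hf : g.comp j = f) :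
    ∀ K ∈ F.restrict f, K.map j ∈ F.restrict g := fun K hK => by
  change (K.map j).map g ∈ F
  rw [Subgroup.map_map, hf]
  exact hK

/-- An object `G/H`, `H ∈ F`, of the orbit category of `G` over `F`. -/
structure OrbitCat {G : Type u} [Group G] (F : SubgroupFamily G) : Type u where
  subgroup : Subgroup G
  mem : subgroup ∈ F

namespace OrbitCat

/-- The morphisms `G/H ⟶ G/K` of the orbit category are the `G`-maps. -/
instance {G : Type u} [Group G] (F : SubgroupFamily G) : SmallCategory (OrbitCat F) where
  Hom X Y := (G ⧸ X.subgroup) →[G] (G ⧸ Y.subgroup)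
  id X := MulActionHom.id G
  comp f g := MulActionHom.comp g f

end OrbitCat

/-- The map `S/H → G/f(H)`, `sH ↦ f(s)f(H)`. -/
def cosetMap {S G : Type u} [Group S] [Group G] (f : S →* G) (H : Subgroup S) :
    S ⧸ H → G ⧸ H.map f :=
  Quotient.map' f (by
    intro a b h
    rw [QuotientGroup.leftRel_apply] at h ⊢
    exact ⟨_, h, by simp⟩)

theorem cosetMap_smul {S G : Type u} [Group S] [Group G] (f : S →* G) (H : Subgroup S)
    (s : S) (x : S ⧸ H) : cosetMap f H (s • x) = f s • cosetMap f H x := by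
  induction x using QuotientGroup.induction_on with
  | H z =>
    change ((f (s * z) : G) : G ⧸ H.map f) = ((f s * f z : G) : G ⧸ H.map f)
    rw [map_mul]

/-- The `G`-map `G/f(H) → G/f(K)`, `f(H) ↦ f(x)f(K)`, induced by the `S`-map
`S/H → S/K`, `H ↦ xK`. -/
def inducedMap {S G : Type u} [Group S] [Group G] (f : S →* G) {H K : Subgroup S}
    (φ : (S ⧸ H) →[S] (S ⧸ K)) : (G ⧸ H.map f) →[G] (G ⧸ K.map f) where
  toFun := Quotient.lift (fun g : G => g • cosetMap f K (φ ((1 : S) : S ⧸ H))) (by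
    intro a b h
    have h' := QuotientGroup.leftRel_apply.1 h
    obtain ⟨s, hs, e⟩ := h'
    have hb : b = a * f s := by rw [e]; group
    have h1 : s • ((1 : S) : S ⧸ H) = ((1 : S) : S ⧸ H) := by
      change ((s * 1 : S) : S ⧸ H) = ((1 : S) : S ⧸ H)
      rw [QuotientGroup.eq]
      simpa using hs
    rw [hb, mul_smul, ← cosetMap_smul, ← map_smul, h1])
  map_smul' g x := by
    induction x using QuotientGroup.induction_on with
    | H z => exact mul_smul g z _

theorem inducedMap_mk {S G : Type u} [Group S] [Group G] (f : S →* G) {H K : Subgroup S}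
    (φ : (S ⧸ H) →[S] (S ⧸ K)) (g : G) :
    inducedMap f φ (g : G ⧸ H.map f) = g • cosetMap f K (φ ((1 : S) : S ⧸ H)) := rfl

theorem inducedMap_cosetMap {S G : Type u} [Group S] [Group G] (f : S →* G) {H K : Subgroup S}
    (φ : (S ⧸ H) →[S] (S ⧸ K)) (x : S ⧸ H) :
    inducedMap f φ (cosetMap f H x) = cosetMap f K (φ x) := by
  induction x using QuotientGroup.induction_on with
  | H z =>
    change inducedMap f φ ((f z : G) : G ⧸ H.map f) = _
    rw [inducedMap_mk, ← cosetMap_smul, ← map_smul]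
    change cosetMap f K (φ ((z * 1 : S) : S ⧸ H)) = _
    rw [mul_one]

/-- The functor `S/H ↦ G/f(H)` between orbit categories induced by a homomorphism
`f : S → G` which maps the members of `E` into `F`. -/
def orbitFunctor {S G : Type u} [Group S] [Group G] {E : SubgroupFamily S}
    {F : SubgroupFamily G} (f : S →* G) (h : ∀ K ∈ E, K.map f ∈ F) :
    OrbitCat E ⥤ OrbitCat F where
  obj X := ⟨X.subgroup.map f, h _ X.mem⟩
  map φ := inducedMap f φ
  map_id X := by
    refine MulActionHom.ext fun x => ?_
    induction x using QuotientGroup.induction_on with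
    | H z =>
      change inducedMap f (MulActionHom.id S) (z : G ⧸ X.subgroup.map f) = (z : G ⧸ _)
      rw [inducedMap_mk]
      change ((z * f 1 : G) : G ⧸ X.subgroup.map f) = (z : G ⧸ _)
      rw [map_one, mul_one]
  map_comp {X Y Z} φ ψ := by
    refine MulActionHom.ext fun x => ?_
    induction x using QuotientGroup.induction_on with
    | H z =>
      change inducedMap f (MulActionHom.comp ψ φ) (z : G ⧸ X.subgroup.map f)
        = inducedMap f ψ (inducedMap f φ (z : G ⧸ X.subgroup.map f))
      rw [inducedMap_mk, inducedMap_mk, map_smul, inducedMap_cosetMap]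
      rfl

/-- The identity `gH ↦ gK` between the orbits of two equal subgroups. -/
def cosetCongr {G : Type u} [Group G] {H K : Subgroup G} (h : H = K) :
    (G ⧸ H) →[G] (G ⧸ K) where
  toFun := Quotient.map' id (by subst h; exact fun _ _ h => h)
  map_smul' g x := by
    induction x using QuotientGroup.induction_on with
    | H z => rfl

/-- Compatibility of the functors between orbit categories with composition of homomorphisms:
`G/g(j(H)) = G/f(H)` if `f = g ∘ j`. -/
def orbitFunctorComp {S T G : Type u} [Group S] [Group T] [Group G]
    {D : SubgroupFamily S} {E : SubgroupFamily T} {F : SubgroupFamily G}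
    (j : S →* T) (g : T →* G) (f : S →* G) (hf : g.comp j = f)
    (hj : ∀ K ∈ D, K.map j ∈ E) (hg : ∀ K ∈ E, K.map g ∈ F) (h : ∀ K ∈ D, K.map f ∈ F) :
    orbitFunctor f h ≅ orbitFunctor j hj ⋙ orbitFunctor g hg :=
  have e (K : Subgroup S) : K.map f = (K.map j).map g := by rw [Subgroup.map_map, hf]
  NatIso.ofComponents
    (fun X =>
      { hom := cosetCongr (e X.subgroup)
        inv := cosetCongr (e X.subgroup).symm
        hom_inv_id := by
          refine MulActionHom.ext fun x => ?_
          induction x using QuotientGroup.induction_on with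
          | H z => rfl
        inv_hom_id := by
          refine MulActionHom.ext fun x => ?_
          induction x using QuotientGroup.induction_on with
          | H z => rfl })
    (by
      intro X Y φ
      refine MulActionHom.ext fun x => ?_
      induction x using QuotientGroup.induction_on with
      | H z =>
        change cosetCongr (e Y.subgroup) (inducedMap f φ (z : G ⧸ X.subgroup.map f))
          = inducedMap g (inducedMap j φ) (z : G ⧸ (X.subgroup.map j).map g)
        rw [inducedMap_mk, inducedMap_mk, map_smul]
        congr 1
        rw [inducedMap_mk, one_smul]
        generalize (show (S ⧸ X.subgroup) →[S] (S ⧸ Y.subgroup) from φ) ((1 : S) : S ⧸ X.subgroup) = y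
        induction y using QuotientGroup.induction_on with
        | H w =>
          subst hf
          rfl)

/-- The category of right modules over the orbit category of `G` over `F`, i.e. of contravariant
functors from the orbit category to abelian groups, with natural transformations as morphisms. -/
abbrev BredonMod {G : Type u} [Group G] (F : SubgroupFamily G) : Type (u + 1) :=
  (OrbitCat F)ᵒᵖ ⥤ AddCommGrpCat.{u}

/-- The trivial module: the constant functor with value the group of integers. -/
def trivialMod {G : Type u} [Group G] (F : SubgroupFamily G) : BredonMod F :=
  (Functor.const _).obj (AddCommGrpCat.of (ULift.{u} ℤ))

instance {G : Type u} [Group G] (F : SubgroupFamily G) :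
    IsGrothendieckAbelian.{u} (BredonMod F) where
  ab5OfSize := { ofShape := fun _ _ _ => inferInstance }

instance {G : Type u} [Group G] (F : SubgroupFamily G) : HasExt.{u} (BredonMod F) :=
  IsGrothendieckAbelian.hasExt _

/-- Bredon cohomology `H^n_F(G, M) = Ext^n(ℤ, M)`, the Ext group being taken in the category of
modules over the orbit category. -/
abbrev BredonCohomology {G : Type u} [Group G] (F : SubgroupFamily G) (M : BredonMod F)
    (n : ℕ) : Type u :=
  Abelian.Ext.{u} (trivialMod F) M n

/-- Restriction of modules along the functor of orbit categories induced by `f`. -/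
abbrev resFunctor {S G : Type u} [Group S] [Group G] {E : SubgroupFamily S}
    {F : SubgroupFamily G} (f : S →* G) (h : ∀ K ∈ E, K.map f ∈ F) :
    BredonMod F ⥤ BredonMod E :=
  (Functor.whiskeringLeft _ _ _).obj (orbitFunctor f h).op

/-- The restriction of the trivial module is the trivial module. -/
def resTrivial {S G : Type u} [Group S] [Group G] {E : SubgroupFamily S}
    {F : SubgroupFamily G} (f : S →* G) (h : ∀ K ∈ E, K.map f ∈ F) :
    trivialMod E ≅ (resFunctor f h).obj (trivialMod F) :=
  NatIso.ofComponents (fun _ => Iso.refl _)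

/-- Transitivity of restriction: `Res_S^T Res_T^G M = Res_S^G M`. -/
def resComp {S T G : Type u} [Group S] [Group T] [Group G]
    {D : SubgroupFamily S} {E : SubgroupFamily T} {F : SubgroupFamily G}
    (j : S →* T) (g : T →* G) (f : S →* G) (hf : g.comp j = f)
    (hj : ∀ K ∈ D, K.map j ∈ E) (hg : ∀ K ∈ E, K.map g ∈ F) (h : ∀ K ∈ D, K.map f ∈ F)
    (M : BredonMod F) :
    (resFunctor j hj).obj ((resFunctor g hg).obj M) ≅ (resFunctor f h).obj M :=
  Functor.isoWhiskerRight (NatIso.op (orbitFunctorComp j g f hf hj hg h)) M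

/-- The restriction map in Bredon cohomology, `H^n_F(G, M) → H^n_E(S, Res M)`: the map induced
on Ext groups by the exact functor of restriction. -/
def cohomologyRes {S G : Type u} [Group S] [Group G] {E : SubgroupFamily S}
    {F : SubgroupFamily G} (f : S →* G) (h : ∀ K ∈ E, K.map f ∈ F) (M : BredonMod F) (n : ℕ) :
    BredonCohomology F M n →+ BredonCohomology E ((resFunctor f h).obj M) n :=
  ((Abelian.Ext.mk₀ (resTrivial f h).hom).precomp _ (zero_add n)).comp
    ((resFunctor f h).mapExtAddHom (trivialMod F) M n)

/-- `Res_S^G M`, for a homomorphism `f : S → G` regarding `S` as a subgroup of `G`. -/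
abbrev SubgroupFamily.res {S G : Type u} [Group S] [Group G] (F : SubgroupFamily G)
    (f : S →* G) (M : BredonMod F) : BredonMod (F.restrict f) :=
  (resFunctor f (F.map_mem f)).obj M

/-- The restriction map `H^n_F(G, M) → H^n_{F ∩ S}(S, Res_S^G M)`. -/
def resMap {S G : Type u} [Group S] [Group G] (F : SubgroupFamily G)
    (f : S →* G) (M : BredonMod F) (n : ℕ) :
    BredonCohomology F M n →+ BredonCohomology (F.restrict f) (F.res f M) n :=
  cohomologyRes f (F.map_mem f) M n

/-- The restriction map
`H^n_{F ∩ T}(T, Res_T^G M) → H^n_{F ∩ S}(S, Res_S^T Res_T^G M) = H^n_{F ∩ S}(S, Res_S^G M)`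
for homomorphisms `j : S → T` and `g : T → G` with `g ∘ j = f`. -/
def resMapSubgroup {S T G : Type u} [Group S] [Group T] [Group G] (F : SubgroupFamily G)
    (j : S →* T) (g : T →* G) (f : S →* G) (hf : g.comp j = f) (M : BredonMod F) (n : ℕ) :
    BredonCohomology (F.restrict g) (F.res g M) n →+
      BredonCohomology (F.restrict f) (F.res f M) n :=
  ((Abelian.Ext.mk₀ (resComp j g f hf (F.map_mem_restrict j g f hf) (F.map_mem g)
      (F.map_mem f) M).hom).postcomp _ (add_zero n)).comp
    (cohomologyRes j (F.map_mem_restrict j g f hf) (F.res g M) n)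

/-- The map `x ↦ (x restricted to A, x restricted to B)`,
`H^n_F(G, M) → H^n_{F ∩ A}(A, Res_A^G M) ⊕ H^n_{F ∩ B}(B, Res_B^G M)`. -/
def mvRes {A B G : Type u} [Group A] [Group B] [Group G] (F : SubgroupFamily G)
    (iA : A →* G) (iB : B →* G) (M : BredonMod F) (n : ℕ) :
    BredonCohomology F M n →+
      BredonCohomology (F.restrict iA) (F.res iA M) n ×
        BredonCohomology (F.restrict iB) (F.res iB M) n :=
  (resMap F iA M n).prod (resMap F iB M n)

/-- The map `(x, y) ↦ (x restricted to C) - (y restricted to C)`,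
`H^n_{F ∩ A}(A, Res_A^G M) ⊕ H^n_{F ∩ B}(B, Res_B^G M) → H^n_{F ∩ C}(C, Res_C^G M)`,
where `iC` is the common value of `iA ∘ φA` and `iB ∘ φB`. -/
def mvDiff {A B C G : Type u} [Group A] [Group B] [Group C] [Group G] (F : SubgroupFamily G)
    (φA : C →* A) (φB : C →* B) (iA : A →* G) (iB : B →* G) (iC : C →* G)
    (hA : iA.comp φA = iC) (hB : iB.comp φB = iC) (M : BredonMod F) (n : ℕ) :
    BredonCohomology (F.restrict iA) (F.res iA M) n ×
        BredonCohomology (F.restrict iB) (F.res iB M) n →+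
      BredonCohomology (F.restrict iC) (F.res iC M) n :=
  (resMapSubgroup F φA iA iC hA M n).comp (AddMonoidHom.fst _ _) -
    (resMapSubgroup F φB iB iC hB M n).comp (AddMonoidHom.snd _ _)

end

/-! The proof runs through the Bass–Serre tree of the amalgam, with vertices `G/A ⊔ G/B` and edges
`G/C`. For `H` in the family, the subgraph fixed by `H` is nonempty, because `H` lies in a conjugate
of `A` or of `B`, and it is again a tree. Its augmented chain complex `0 → ℤ[(G/C)^H] → ℤ[(G/A)^H] ⊕
ℤ[(G/B)^H] → ℤ → 0` is therefore exact. Letting `H` vary gives a short exact sequence of Bredon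
modules (`permMod.shortExact`), to which the long exact sequence of `Ext(-, M)` applies
(`Abelian.Ext.mayerVietoris`).

The terms are identified by a Shapiro lemma (`extPermMod_bijective`): `Ext^n(ℤ[(G/S)^?], M)` is the
Bredon cohomology of `S` with coefficients in `Res M`. The orbits of `S` are the orbits of `G`
equipped with a map to `G/S`, so restriction to `S` is, up to an equivalence, restriction along the
projection from a category of elements. The left adjoint of the latter is a fibrewise coproduct and
preserves monomorphisms, so restriction preserves injectives. A universal arrow then gives the
isomorphism in degree 0, and dimension shifting carries it to all degrees
(`Functor.precomp_mapExt_bijective`). `extPermMod_aug` and `extPermMod_cosetProj` match the maps of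
the sequence with restriction maps.

The tree properties come from the universal property of the pushout. By
`IsPushout.group_exists_sub`, a function on `G/C` is a difference of functions pulled back from
`G/A` and `G/B`. This splits the boundary map, hence its injectivity on fixed points. Applied modulo
2 to the indicator function of one edge, it gives a cut of the vertex set crossed by that edge
alone. Such cuts, with connectedness, are all that is needed of a tree to show that fixed subgraphs
are connected (`eq_of_forall_fixed_edge`). -/

namespace CategoryTheory

open Limits Abelian

universe w w' v v' v'' u' u''

/-! ### Exact functors and `Ext` -/

section

variable {C : Type u} [Category.{v} C] [Abelian C] {D : Type u'} [Category.{v'} D] [Abelian D]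
  [HasExt.{w} C] [HasExt.{w'} D]

/-- In a category with enough injectives, every `Ext`-class of positive degree is the product of
a class of smaller degree with the class of a short exact sequence. -/
lemma Abelian.Ext.exists_comp_extClass [EnoughInjectives C] {X Y : C} {n : ℕ}
    (x : Ext.{w} X Y (n + 1)) :
    ∃ (S : ShortComplex C) (hS : S.ShortExact) (e : S.X₁ = Y) (y : Ext.{w} X S.X₃ n),
      x = e ▸ y.comp hS.extClass rfl := by
  let I : InjectivePresentation Y := Classical.arbitrary _
  let S := ShortComplex.mk _ _ (cokernel.condition I.f)
  have : Injective S.X₂ := I.injective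
  have hS : S.ShortExact := { exact := ShortComplex.exact_cokernel I.f }
  obtain ⟨y, hy⟩ := Ext.covariant_sequence_exact₁ X hS x (Ext.eq_zero_of_injective _) rfl
  exact ⟨S, hS, rfl, y, hy.symm⟩

/-- The maps on `Ext`-groups induced by exact functors are compatible with natural
transformations. -/
lemma Abelian.Ext.mapExactFunctor_natTrans [EnoughInjectives C] {F F' : C ⥤ D} [F.Additive]
    [PreservesFiniteLimits F] [PreservesFiniteColimits F] [F'.Additive]
    [PreservesFiniteLimits F'] [PreservesFiniteColimits F'] (τ : F ⟶ F') {X Y : C} {n : ℕ}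
    (x : Ext.{w} X Y n) :
    (x.mapExactFunctor F).comp (Ext.mk₀ (τ.app Y)) (add_zero n) =
      (Ext.mk₀ (τ.app X)).comp (x.mapExactFunctor F' : Ext.{w'} _ _ n) (zero_add n) := by
  induction n generalizing Y with
  | zero =>
    obtain ⟨f, rfl⟩ := (Ext.mk₀_bijective X Y).2 x
    simp [Ext.mapExactFunctor_mk₀]
  | succ n ih =>
    obtain ⟨S, hS, rfl, y, rfl⟩ := x.exists_comp_extClass
    -- After dimension shifting only the degree one factor is left: `τ` is a morphism between the
    -- two images of the short exact sequence, and extension classes are natural.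
    have key : (hS.extClass.mapExactFunctor F).comp (Ext.mk₀ (τ.app S.X₁)) (add_zero 1) =
        (Ext.mk₀ (τ.app S.X₃)).comp (hS.extClass.mapExactFunctor F' : Ext.{w'} _ _ 1)
          (zero_add 1) := by
      rw [Ext.mapExactFunctor_extClass, Ext.mapExactFunctor_extClass]
      exact ShortComplex.ShortExact.extClass_naturality _ (hS.map_of_exact F') (S.mapNatTrans τ)
    dsimp only
    rw [Ext.mapExactFunctor_comp, Ext.mapExactFunctor_comp, Ext.comp_assoc_of_third_deg_zero,
      key, ← Ext.comp_assoc_of_second_deg_zero, ih y, Ext.comp_assoc _ _ _ _ _ (by lia)]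

/-- Dimension shifting reduces this to morphisms and to classes of short exact sequences; for these,
both sides come from the same image under the composite functor. -/
lemma Abelian.Ext.mapExactFunctor_functor_comp [EnoughInjectives C]
    {E : Type u''} [Category.{v''} E] [Abelian E] [HasExt.{w} E] (F : C ⥤ D) (F' : D ⥤ E)
    [F.Additive] [PreservesFiniteLimits F] [PreservesFiniteColimits F] [F'.Additive]
    [PreservesFiniteLimits F'] [PreservesFiniteColimits F']
    [PreservesFiniteLimits (F ⋙ F')] [PreservesFiniteColimits (F ⋙ F')] {X Y : C} {n : ℕ}
    (x : Ext.{w} X Y n) :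
    (x.mapExactFunctor (F ⋙ F') : Ext.{w} _ _ n) =
      (x.mapExactFunctor F : Ext.{w'} _ _ n).mapExactFunctor F' := by
  induction n generalizing Y with
  | zero =>
    obtain ⟨f, rfl⟩ := (Ext.mk₀_bijective X Y).2 x
    simp [Ext.mapExactFunctor_mk₀]
  | succ n ih =>
    obtain ⟨S, hS, rfl, y, rfl⟩ := x.exists_comp_extClass
    have key : (hS.extClass.mapExactFunctor (F ⋙ F') : Ext.{w} _ _ 1) =
        (hS.extClass.mapExactFunctor F : Ext.{w'} _ _ 1).mapExactFunctor F' := by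
      rw [Ext.mapExactFunctor_extClass, Ext.mapExactFunctor_extClass]
      exact (Ext.mapExactFunctor_extClass F' (hS.map_of_exact F)).symm
    dsimp only
    rw [Ext.mapExactFunctor_comp, Ext.mapExactFunctor_comp, Ext.mapExactFunctor_comp, ih y, key]

variable (F : C ⥤ D) [F.Additive] [PreservesFiniteLimits F] [PreservesFiniteColimits F]

/-- If `η : Y ⟶ F.obj X` is a universal arrow from `Y` to an exact functor `F` preserving
injective objects, then `F` and `η` induce isomorphisms `Ext X M n ≃ Ext Y (F.obj M) n`. -/
lemma Functor.precomp_mapExt_bijective [EnoughInjectives C] [F.PreservesInjectiveObjects]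
    {X : C} {Y : D} (η : Y ⟶ F.obj X)
    (h : ∀ M : C, Function.Bijective fun f : X ⟶ M => η ≫ F.map f) (M : C) (n : ℕ) :
    Function.Bijective (((Ext.mk₀ η).precomp _ (zero_add n)).comp
      (F.mapExtAddHom X M n) : Ext.{w} X M n →+ Ext.{w'} Y (F.obj M) n) := by
  induction n generalizing M with
  | zero =>
    have e : (((Ext.mk₀ η).precomp _ (zero_add 0)).comp
      (F.mapExtAddHom X M 0) : Ext.{w} X M 0 → Ext.{w'} Y (F.obj M) 0) =
        Ext.homEquiv₀.symm ∘ (fun f => η ≫ F.map f) ∘ Ext.homEquiv₀ := by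
      ext x
      obtain ⟨f, rfl⟩ := (Ext.mk₀_bijective X M).2 x
      simp [Ext.mapExactFunctor_mk₀, Ext.homEquiv₀]
    rw [e]
    exact Ext.homEquiv₀.symm.bijective.comp ((h M).comp Ext.homEquiv₀.bijective)
  | succ n ih =>
    let I : InjectivePresentation M := Classical.arbitrary _
    let S := ShortComplex.mk _ _ (cokernel.condition I.f)
    have : Injective S.X₂ := I.injective
    have : Injective (S.map F).X₂ := Functor.PreservesInjectiveObjects.injective_obj I.injective
    have hS : S.ShortExact := { exact := ShortComplex.exact_cokernel I.f }
    -- Both `I` and `F.obj I` are injective, so the two rows present `Ext^(n+1)` as the cokernel of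
    -- `Ext^n(-, I) → Ext^n(-, I/M)`; the comparison maps on these are known by induction.
    exact AddMonoidHom.bijective_of_surjective_of_bijective_of_right_exact _ _ _ _
      (((Ext.mk₀ η).precomp _ (zero_add n)).comp (F.mapExtAddHom X S.X₂ n))
      (((Ext.mk₀ η).precomp _ (zero_add n)).comp (F.mapExtAddHom X S.X₃ n))
      (((Ext.mk₀ η).precomp _ (zero_add (n + 1))).comp (F.mapExtAddHom X S.X₁ (n + 1)))
      (by
        ext x
        change ((Ext.mk₀ η).comp (x.mapExactFunctor F) (zero_add n)).comp (Ext.mk₀ (F.map S.g))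
          (add_zero n) = (Ext.mk₀ η).comp ((x.comp (Ext.mk₀ S.g) (add_zero n)).mapExactFunctor F)
          (zero_add n)
        rw [Ext.mapExactFunctor_comp, Ext.mapExactFunctor_mk₀, Ext.comp_assoc_of_third_deg_zero])
      (by
        ext x
        have key := Ext.mapExactFunctor_extClass.{w, w'} F hS
        change ((Ext.mk₀ η).comp (x.mapExactFunctor F) (zero_add n)).comp
          (hS.map_of_exact F).extClass rfl = (Ext.mk₀ η).comp
            ((x.comp hS.extClass rfl).mapExactFunctor F) (zero_add (n + 1))
        rw [Ext.mapExactFunctor_comp, key]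
        exact Ext.comp_assoc _ _ _ _ _ (by lia))
      ((ShortComplex.ab_exact_iff_function_exact _).mp
        (Ext.covariant_sequence_exact₃' X hS n (n + 1) rfl))
      ((ShortComplex.ab_exact_iff_function_exact _).mp
        (Ext.covariant_sequence_exact₃' Y (hS.map F) n (n + 1) rfl))
      (ih _).surjective (ih _)
      (fun x₁ ↦ Ext.covariant_sequence_exact₁ _ hS x₁ (Ext.eq_zero_of_injective _) rfl)
      (fun y₁ ↦ Ext.covariant_sequence_exact₁ _ (hS.map F) y₁ (Ext.eq_zero_of_injective _) rfl)

end

/-! ### Mayer–Vietoris for `Ext` -/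

section

variable {C : Type u} [Category.{v} C] [Abelian C] [HasExt.{w} C]

/-- The Mayer-Vietoris sequence of `Ext`-groups attached to a short exact sequence whose middle
term is a biproduct. -/
lemma Abelian.Ext.mayerVietoris {P Q₁ Q₂ R : C} (q₁ : P ⟶ Q₁) (q₂ : P ⟶ Q₂) (p₁ : Q₁ ⟶ R)
    (p₂ : Q₂ ⟶ R) (h : biprod.lift q₁ (-q₂) ≫ biprod.desc p₁ p₂ = 0)
    (hS : (ShortComplex.mk _ _ h).ShortExact) (M : C) :
    let α (n : ℕ) : Ext.{w} R M n →+ Ext.{w} Q₁ M n × Ext.{w} Q₂ M n :=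
      ((Ext.mk₀ p₁).precomp M (zero_add n)).prod ((Ext.mk₀ p₂).precomp M (zero_add n))
    let β (n : ℕ) : Ext.{w} Q₁ M n × Ext.{w} Q₂ M n →+ Ext.{w} P M n :=
      ((Ext.mk₀ q₁).precomp M (zero_add n)).comp (AddMonoidHom.fst _ _) -
        ((Ext.mk₀ q₂).precomp M (zero_add n)).comp (AddMonoidHom.snd _ _)
    let δ (n : ℕ) : Ext.{w} P M n →+ Ext.{w} R M (n + 1) :=
      hS.extClass.precomp M (add_comm 1 n)
    Function.Injective (α 0) ∧ ∀ n, Function.Exact (α n) (β n) ∧ Function.Exact (β n) (δ n) ∧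
      Function.Exact (δ n) (α (n + 1)) := by
  intro α β δ
  -- Under `Ext.biprodAddEquiv`, pullback along the two maps of the short exact sequence becomes `α`
  -- and `β`. The sign in `biprod.lift` makes `β` a difference and leaves `α` unsigned.
  have hdesc (n : ℕ) (x : Ext.{w} R M n) :
      Ext.biprodAddEquiv ((Ext.mk₀ (biprod.desc p₁ p₂)).comp x (zero_add n)) = α n x := by
    simp [α, Ext.biprodAddEquiv]
  have hlift (n : ℕ) (x : Ext.{w} (Q₁ ⊞ Q₂) M n) :
      (Ext.mk₀ (biprod.lift q₁ (-q₂))).comp x (zero_add n) = β n (Ext.biprodAddEquiv x) := by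
    have e : biprod.lift q₁ (-q₂) = q₁ ≫ biprod.inl - q₂ ≫ biprod.inr := by
      ext <;> simp
    simp [β, Ext.biprodAddEquiv, e, sub_eq_add_neg, Ext.mk₀_add, Ext.mk₀_neg]
  refine ⟨fun x y hxy => ?_, fun n => ⟨?_, ?_, ?_⟩⟩
  · have := hS.epi_g
    refine Ext.precomp_mk₀_injective_of_epi M (biprod.desc p₁ p₂) ?_
    apply Ext.biprodAddEquiv.injective
    exact (hdesc 0 x).trans (hxy.trans (hdesc 0 y).symm)
  · intro y
    obtain ⟨y, rfl⟩ := Ext.biprodAddEquiv.surjective y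
    rw [← hlift]
    constructor
    · intro hy
      obtain ⟨x, hx⟩ := Ext.contravariant_sequence_exact₂ hS M y hy
      exact ⟨x, by rw [← hx, ← hdesc]⟩
    · rintro ⟨x, hx⟩
      rw [← hdesc] at hx
      rw [← Ext.biprodAddEquiv.injective hx, Ext.mk₀_comp_mk₀_assoc, h, Ext.mk₀_zero,
        Ext.zero_comp]
  · intro z
    constructor
    · intro hz
      obtain ⟨y, hy⟩ := Ext.contravariant_sequence_exact₁ hS M z (add_comm 1 n) hz
      exact ⟨Ext.biprodAddEquiv y, by rw [← hlift, ← hy]⟩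
    · rintro ⟨y, rfl⟩
      obtain ⟨y, rfl⟩ := Ext.biprodAddEquiv.surjective y
      rw [← hlift]
      exact hS.extClass_comp_assoc y (h := add_comm 1 n)
  · intro x
    rw [← hdesc]
    simp only [map_eq_zero_iff _ Ext.biprodAddEquiv.injective]
    constructor
    · intro hx
      exact Ext.contravariant_sequence_exact₃ hS M x hx (add_comm 1 n)
    · rintro ⟨z, rfl⟩
      exact hS.comp_extClass_assoc z (add_comm 1 n)

end

end CategoryTheory

/-! ### Trees described by edge cuts, and their fixed points -/

section Tree

variable {V E : Type*} {s t : E → V} {φ : E → V → Bool}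

/-- If the edge cuts `φ` of a connected graph separate the ends of exactly one edge each, then
two distinct vertices are separated by the cut of an edge at the first one. -/
theorem exists_edge_separating
    (conn : ∀ p : V → Prop, (∀ e, p (s e) ↔ p (t e)) → ∀ v w, p v → p w)
    (hφ : ∀ e, φ e (s e) ≠ φ e (t e)) (hφ' : ∀ e e', e' ≠ e → φ e (s e') = φ e (t e'))
    {v w : V} (hvw : v ≠ w) : ∃ e, (s e = v ∨ t e = v) ∧ φ e v ≠ φ e w := by
  by_contra! hcon
  -- Take `v` together with all vertices cut off from `v` by an edge at `v`. An edge at `v` has both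
  -- ends in this set, and any other edge crosses none of the cuts involved; so the set contains
  -- `w`.
  have := conn (fun u => u = v ∨ ∃ e, (s e = v ∨ t e = v) ∧ φ e v ≠ φ e u) (fun e' => by
    by_cases he' : s e' = v ∨ t e' = v
    · refine iff_of_true ?_ ?_
      · rcases he' with h | h
        · exact Or.inl h
        · exact Or.inr ⟨e', Or.inr h, by rw [← h]; exact (hφ e').symm⟩
      · rcases he' with h | h
        · exact Or.inr ⟨e', Or.inl h, by rw [← h]; exact hφ e'⟩
        · exact Or.inl h
    · have h1 : ∀ e, (s e = v ∨ t e = v) → φ e (s e') = φ e (t e') := fun e he =>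
        hφ' e e' (by rintro rfl; exact he' he)
      push Not at he'
      simp only [he'.1, he'.2, false_or]
      exact exists_congr fun e => and_congr_right fun he => by rw [h1 e he]) v w (Or.inl rfl)
  rcases this with h | ⟨e, he, h⟩
  · exact hvw h.symm
  · exact h (hcon e he)

/-- If `e ≠ e'`, look at the vertices beyond both cuts as seen from `v`. The edge `e` stays on the
near side of the cut of `e'` and conversely, so no edge enters this region. It contains `w` but not
`v`, against connectedness. -/
theorem edge_separating_unique
    (conn : ∀ p : V → Prop, (∀ e, p (s e) ↔ p (t e)) → ∀ v w, p v → p w)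
    (hφ' : ∀ e e', e' ≠ e → φ e (s e') = φ e (t e'))
    {v w : V} {e e' : E} (he : s e = v ∨ t e = v) (he' : s e' = v ∨ t e' = v)
    (h : φ e v ≠ φ e w) (h' : φ e' v ≠ φ e' w) : e = e' := by
  by_contra hne
  have aux : ∀ e₁ e₂, e₁ ≠ e₂ → (s e₁ = v ∨ t e₁ = v) →
      φ e₂ (s e₁) = φ e₂ v ∧ φ e₂ (t e₁) = φ e₂ v := by
    rintro e₁ e₂ h12 (rfl | rfl)
    · exact ⟨rfl, (hφ' _ _ h12).symm⟩
    · exact ⟨hφ' _ _ h12, rfl⟩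
  have := conn (fun u => φ e u ≠ φ e v ∧ φ e' u ≠ φ e' v) (fun e'' => by
    by_cases h1 : e'' = e
    · subst h1
      simp [aux _ _ hne he]
    · by_cases h2 : e'' = e'
      · subst h2
        simp [aux _ _ h1 he']
      · rw [hφ' _ _ h1, hφ' _ _ h2]) w v ⟨h.symm, h'.symm⟩
  exact this.1 rfl

/-- Moving `w` across an edge `e₀` changes the set at most by `e₀`, so finiteness propagates from `w
= v`. -/
theorem finite_setOf_separating
    (conn : ∀ p : V → Prop, (∀ e, p (s e) ↔ p (t e)) → ∀ v w, p v → p w)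
    (hφ' : ∀ e e', e' ≠ e → φ e (s e') = φ e (t e')) (v w : V) :
    {e | φ e v ≠ φ e w}.Finite := by
  refine conn (fun w => {e | φ e v ≠ φ e w}.Finite) (fun e₀ => ?_) v w (by simp)
  constructor <;> refine fun h => (h.insert e₀).subset fun e he => ?_ <;>
    by_cases h0 : e = e₀ <;> simp_all [hφ' e e₀ (Ne.symm _)]

/-- In a tree with an action of a group `H`, the subgraph of the points fixed by `H` is
connected. -/
theorem eq_of_forall_fixed_edge {H : Type*} [Group H] [MulAction H V] [MulAction H E]
    (hs : ∀ (h : H) e, s (h • e) = h • s e) (ht : ∀ (h : H) e, t (h • e) = h • t e)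
    (conn : ∀ p : V → Prop, (∀ e, p (s e) ↔ p (t e)) → ∀ v w, p v → p w)
    (hφ : ∀ e, φ e (s e) ≠ φ e (t e)) (hφ' : ∀ e e', e' ≠ e → φ e (s e') = φ e (t e'))
    {X : Type*} (f : V → X) (hf : ∀ e, (∀ h : H, h • e = e) → f (s e) = f (t e))
    {v w : V} (hv : ∀ h : H, h • v = v) (hw : ∀ h : H, h • w = w) : f v = f w := by
  have hequiv : ∀ (h : H) (e : E) (v w : V), φ e v ≠ φ e w →
      φ (h • e) (h • v) ≠ φ (h • e) (h • w) := by
    intro h e v w hne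
    -- The cuts are not assumed equivariant. Still, the cut of `h • e` pulled back along `h` and the
    -- cut of `e` flip across the same single edge, so they separate the same pairs of vertices.
    have := conn (fun u => φ (h • e) (h • v) = φ (h • e) (h • u) ↔ φ e v = φ e u) (fun e' => by
      by_cases he : e' = e
      · subst he
        clear hne
        have h1 := hφ e'
        have h2 := hφ (h • e')
        rw [hs, ht] at h2
        generalize φ e' v = a at *
        generalize φ (h • e') (h • v) = b at *
        generalize φ e' (s e') = x at *
        generalize φ e' (t e') = y at *
        generalize φ (h • e') (h • s e') = z at *
        generalize φ (h • e') (h • t e') = w at *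
        revert h1 h2
        revert a b x y z w
        decide
      · have := hφ' (h • e) (h • e') (fun h' => he (MulAction.injective h h'))
        rw [hs, ht] at this
        rw [this, hφ' _ _ he]) v w (by simp)
    exact fun h' => hne (this.1 h')
  have hfin := finite_setOf_separating conn hφ'
  -- Walk from `v` towards `w`; the number of separating edges plays the role of the distance.
  induction hn : {e | φ e v ≠ φ e w}.ncard using Nat.strong_induction_on generalizing v with
  | _ n ih =>
  by_cases hvw : v = w
  · rw [hvw]
  obtain ⟨e, he, hsep⟩ := exists_edge_separating conn hφ hφ' hvw
  -- The edge `h • e` also starts at `v` and separates `v` from `w`, since `h` fixes both;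
  -- uniqueness gives `h • e = e`.
  have hfix : ∀ h : H, h • e = e := fun h => by
    refine edge_separating_unique (v := v) (w := w) conn hφ' ?_ he ?_ hsep
    · rw [hs, ht]
      rcases he with he | he
      · exact Or.inl (by rw [he, hv])
      · exact Or.inr (by rw [he, hv])
    · have := hequiv h e v w hsep
      rwa [hv, hw] at this
  -- Here `v'` is the other end of `e`. Only the cut of `e` distinguishes it from `v`, so passing to
  -- `v'` removes exactly `e` from the separating edges.
  have main : ∀ v', (∀ e', e' ≠ e → φ e' v = φ e' v') → φ e v ≠ φ e v' → (∀ h : H, h • v' = v') →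
      f v = f v' → f v = f w := by
    intro v' h1 h2 h3 h4
    rw [h4]
    refine ih _ ?_ h3 rfl
    rw [← hn]
    refine Set.ncard_lt_ncard ⟨fun e' he' => ?_, fun hsub => ?_⟩ (hfin v w)
    · by_cases hee : e' = e
      · subst hee
        exact hsep
      · simpa [h1 e' hee] using he'
    · have h5 := hsub hsep
      simp only [Set.mem_ofPred_eq] at h5
      generalize φ e v = a at *
      generalize φ e v' = b at *
      generalize φ e w = c at *
      revert a b c
      decide
  rcases he with rfl | rfl
  · refine main (t e) (fun e' he' => hφ' e' e he'.symm) (hφ e) (fun h => ?_) (hf e hfix)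
    rw [← ht, hfix]
  · refine main (s e) (fun e' he' => (hφ' e' e he'.symm).symm) (hφ e).symm (fun h => ?_)
      (hf e hfix).symm
    rw [← hs, hfix]

end Tree

/-! ### The Bass–Serre tree of an amalgam -/

/-- The projection `G/H → G/K`, for `H ≤ K`. -/
def cosetProj {G : Type u} [Group G] {H K : Subgroup G} (h : H ≤ K) : (G ⧸ H) →[G] (G ⧸ K) where
  toFun := Subgroup.quotientMapOfLE h
  map_smul' g x := by
    induction x using QuotientGroup.induction_on with
    | H z => rfl

@[simp]
theorem cosetProj_mk {G : Type u} [Group G] {H K : Subgroup G} (h : H ≤ K) (g : G) :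
    cosetProj h (g : G ⧸ H) = (g : G ⧸ K) := rfl

section Amalgam

variable {A B C G : Type u} [Group A] [Group B] [Group C] [Group G]
  {φA : C →* A} {φB : C →* B} {iA : A →* G} {iB : B →* G} {iC : C →* G}

theorem MonoidHom.range_le_of_comp_eq {j : C →* A} {g : A →* G} {f : C →* G} (h : g.comp j = f) :
    f.range ≤ g.range := by
  rintro _ ⟨c, rfl⟩
  exact ⟨j c, by rw [← h]; rfl⟩

/-- The factors embed in the concrete model `Monoid.PushoutI`, and these embeddings factor through
`G` by the universal property. -/
theorem CategoryTheory.IsPushout.group_injective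
    (hG : IsPushout (GrpCat.ofHom φA) (GrpCat.ofHom φB) (GrpCat.ofHom iA) (GrpCat.ofHom iB))
    (hφA : Function.Injective φA) (hφB : Function.Injective φB) :
    Function.Injective iA ∧ Function.Injective iB := by
  let T : Bool → Type u := fun b => cond b A B
  let instT : ∀ b, Group (T b) := fun b => by cases b <;> (dsimp [T]; infer_instance)
  let ψ : ∀ b, C →* T b := fun b => match b with
    | true => φA
    | false => φB
  have hψ : ∀ b, Function.Injective (ψ b) := fun b => by
    cases b
    · exact hφB
    · exact hφA
  have hinj := Monoid.PushoutI.of_injective hψ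
  let a : A →* Monoid.PushoutI ψ := Monoid.PushoutI.of (φ := ψ) true
  let b : B →* Monoid.PushoutI ψ := Monoid.PushoutI.of (φ := ψ) false
  have hab : a.comp φA = b.comp φB :=
    (Monoid.PushoutI.of_comp_eq_base (φ := ψ) true).trans
      (Monoid.PushoutI.of_comp_eq_base (φ := ψ) false).symm
  have w : GrpCat.ofHom φA ≫ GrpCat.ofHom a = GrpCat.ofHom φB ≫ GrpCat.ofHom b := by
    rw [← GrpCat.ofHom_comp, ← GrpCat.ofHom_comp, hab]
  let d : G →* Monoid.PushoutI ψ := (hG.desc (GrpCat.ofHom a) (GrpCat.ofHom b) w).hom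
  have ha : d.comp iA = a := congrArg GrpCat.Hom.hom (hG.inl_desc _ _ w)
  have hb : d.comp iB = b := congrArg GrpCat.Hom.hom (hG.inr_desc _ _ w)
  constructor
  · refine Function.Injective.of_comp (f := d) ?_
    rw [← MonoidHom.coe_comp, ha]
    exact hinj true
  · refine Function.Injective.of_comp (f := d) ?_
    rw [← MonoidHom.coe_comp, hb]
    exact hinj false

theorem CategoryTheory.IsPushout.group_exists_lift
    (hG : IsPushout (GrpCat.ofHom φA) (GrpCat.ofHom φB) (GrpCat.ofHom iA) (GrpCat.ofHom iB))
    {K : Type u} [Group K] (a : A →* K) (b : B →* K) (hab : a.comp φA = b.comp φB) :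
    ∃ d : G →* K, d.comp iA = a ∧ d.comp iB = b := by
  have w : GrpCat.ofHom φA ≫ GrpCat.ofHom a = GrpCat.ofHom φB ≫ GrpCat.ofHom b := by
    rw [← GrpCat.ofHom_comp, ← GrpCat.ofHom_comp, hab]
  exact ⟨(hG.desc (GrpCat.ofHom a) (GrpCat.ofHom b) w).hom,
    congrArg GrpCat.Hom.hom (hG.inl_desc _ _ w), congrArg GrpCat.Hom.hom (hG.inr_desc _ _ w)⟩

/-- The universal property produces a homomorphism `G → K` whose composite with the inclusion of `K`
agrees with the identity on both factors. -/
theorem CategoryTheory.IsPushout.group_closure_eq_top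
    (hG : IsPushout (GrpCat.ofHom φA) (GrpCat.ofHom φB) (GrpCat.ofHom iA) (GrpCat.ofHom iB))
    (K : Subgroup G) (hA : ∀ a, iA a ∈ K) (hB : ∀ b, iB b ∈ K) (g : G) : g ∈ K := by
  have hw : iA.comp φA = iB.comp φB := congrArg GrpCat.Hom.hom hG.w
  obtain ⟨d, hdA, hdB⟩ := hG.group_exists_lift (iA.codRestrict K hA) (iB.codRestrict K hB) (by
    ext c
    exact DFunLike.congr_fun hw c)
  have : GrpCat.ofHom (K.subtype.comp d) = 𝟙 (GrpCat.of G) := by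
    apply hG.hom_ext
    · rw [← GrpCat.ofHom_comp, MonoidHom.comp_assoc, hdA]
      rfl
    · rw [← GrpCat.ofHom_comp, MonoidHom.comp_assoc, hdB]
      rfl
  have h := DFunLike.congr_fun (congrArg GrpCat.Hom.hom this) g
  change (d g : G) = g at h
  exact h ▸ (d g).2

/-- A function on an amalgam which is invariant under the right translations by `C` is the
difference of functions invariant under `A` and under `B`. -/
theorem CategoryTheory.IsPushout.group_exists_sub
    (hG : IsPushout (GrpCat.ofHom φA) (GrpCat.ofHom φB) (GrpCat.ofHom iA) (GrpCat.ofHom iB))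
    (hA : iA.comp φA = iC)
    {D : Type u} [AddCommGroup D] (c : G → D) (hc : ∀ g z, c (g * iC z) = c g) :
    ∃ a b : G → D, (∀ g x, a (g * iA x) = a g) ∧ (∀ g y, b (g * iB y) = b g) ∧
      ∀ g, c g = a g - b g := by
  have hB : iB.comp φB = iC := by
    rw [← hA]
    exact (congrArg GrpCat.Hom.hom hG.w).symm
  -- `G` acts on `D × G` by right translation; `τ` shears the first coordinate by `c`. As `c` is
  -- invariant under `C`, the shear commutes with the action of `C`. Hence the sheared action on `A`
  -- and the plain action on `B` agree on `C` and glue to an action `Φ` of `G`.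
  let ρ : G →* Equiv.Perm (D × G) :=
    { toFun x := Equiv.prodCongr (Equiv.refl D) (Equiv.mulRight x⁻¹)
      map_one' := by ext p <;> simp
      map_mul' x y := by ext p <;> simp [mul_assoc] }
  have hρ : ∀ x p, ρ x p = (p.1, p.2 * x⁻¹) := fun x p => rfl
  let τ : Equiv.Perm (D × G) :=
    { toFun p := (p.1 + c p.2, p.2)
      invFun p := (p.1 - c p.2, p.2)
      left_inv p := by simp
      right_inv p := by simp }
  have hτ : ∀ p, τ p = (p.1 + c p.2, p.2) := fun p => rfl
  have hτ' : ∀ p, τ⁻¹ p = (p.1 - c p.2, p.2) := fun p => rfl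
  let σ : Equiv.Perm (D × G) →* Equiv.Perm (D × G) := (MulAut.conj τ⁻¹).toMonoidHom
  have hσ : ∀ x p, σ (ρ x) p = (p.1 + c p.2 - c (p.2 * x⁻¹), p.2 * x⁻¹) := fun x p => by
    simp [σ, hρ, hτ, hτ', Equiv.Perm.mul_apply]
  obtain ⟨Φ, hΦA, hΦB⟩ := hG.group_exists_lift ((σ.comp ρ).comp iA) (ρ.comp iB) (by
    refine MonoidHom.ext fun z => Equiv.ext fun p => ?_
    change σ (ρ (iA.comp φA z)) p = ρ (iB.comp φB z) p
    rw [hA, hB, hσ, hρ, ← map_inv, hc, add_sub_cancel_right])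
  replace hΦA : ∀ x p, Φ (iA x) p = (p.1 + c p.2 - c (p.2 * (iA x)⁻¹), p.2 * (iA x)⁻¹) :=
    fun x p => (DFunLike.congr_fun (DFunLike.congr_fun hΦA x) p).trans (hσ _ _)
  replace hΦB : ∀ y p, Φ (iB y) p = (p.1, p.2 * (iB y)⁻¹) :=
    fun y p => (DFunLike.congr_fun (DFunLike.congr_fun hΦB y) p).trans (hρ _ _)
  have hsnd : ∀ g : G, ∀ p, (Φ g p).2 = p.2 * g⁻¹ :=
    hG.group_closure_eq_top
      { carrier := {g | ∀ p, (Φ g p).2 = p.2 * g⁻¹}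
        one_mem' := fun p => by simp
        mul_mem' := fun {x y} hx hy p => by
          rw [map_mul, Equiv.Perm.mul_apply, hx, hy]
          group
        inv_mem' := fun {x} hx p => by
          have := hx ((Φ x)⁻¹ p)
          rw [← Equiv.Perm.mul_apply, mul_inv_cancel, Equiv.Perm.one_apply] at this
          rw [map_inv, this]
          group }
      (fun x p => by rw [hΦA]) (fun y p => by rw [hΦB])
  -- `w` records how far `Φ` shifts the first coordinate along the orbit of `(0, 1)`. Elements of
  -- `B` do not shift, and `x ∈ A` contributes `c g - c (g * x)`; so `w` is invariant under `B` and
  -- `w + c` under `A`.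
  let w : G → D := fun g => (Φ g⁻¹ (0, 1)).1
  have hw : ∀ g, Φ g⁻¹ (0, 1) = (w g, g) := fun g => Prod.ext rfl ((hsnd _ _).trans (by simp))
  have hmul : ∀ g x, Φ (g * x)⁻¹ (0, 1) = Φ x⁻¹ (w g, g) := fun g x => by
    rw [mul_inv_rev, map_mul, Equiv.Perm.mul_apply, hw]
  refine ⟨fun g => w g + c g, w, fun g x => ?_, fun g y => ?_, fun g => by simp⟩
  · have := congrArg _root_.Prod.fst (hmul g (iA x))
    rw [hw, ← map_inv, hΦA, map_inv, inv_inv] at this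
    simp only at this
    change w _ + c _ = w g + c g
    rw [this, sub_add_cancel]
  · have := congrArg _root_.Prod.fst (hmul g (iB y))
    rw [hw, ← map_inv, hΦB] at this
    exact this

variable (hG : IsPushout (GrpCat.ofHom φA) (GrpCat.ofHom φB) (GrpCat.ofHom iA) (GrpCat.ofHom iB))
  (hA : iA.comp φA = iC) (hB : iB.comp φB = iC)

include hG in
/-- The boundary `ℤ[G/C] → ℤ[G/A] ⊕ ℤ[G/B]` of the Bass-Serre tree is a split injection, in dual
form. -/
theorem CategoryTheory.IsPushout.exists_coset_sub {D : Type u} [AddCommGroup D]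
    (c : G ⧸ iC.range → D) :
    ∃ (a : G ⧸ iA.range → D) (b : G ⧸ iB.range → D), ∀ e, c e =
      a (cosetProj (MonoidHom.range_le_of_comp_eq hA) e) -
        b (cosetProj (MonoidHom.range_le_of_comp_eq hB) e) := by
  obtain ⟨a, b, ha, hb, hab⟩ := hG.group_exists_sub hA (fun g => c (g : G ⧸ iC.range))
    (fun g z => congrArg c (QuotientGroup.mk_mul_of_mem g ⟨z, rfl⟩))
  refine ⟨_root_.Quotient.lift a ?_, _root_.Quotient.lift b ?_, fun e => ?_⟩
  · intro x y h
    obtain ⟨z, hz⟩ := QuotientGroup.leftRel_apply.1 h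
    rw [← ha x z, hz, mul_inv_cancel_left]
  · intro x y h
    obtain ⟨z, hz⟩ := QuotientGroup.leftRel_apply.1 h
    rw [← hb x z, hz, mul_inv_cancel_left]
  · induction e using QuotientGroup.induction_on with
    | H g => exact hab g

include hG in
/-- The Bass-Serre tree is connected. -/
theorem CategoryTheory.IsPushout.coset_connected (p : (G ⧸ iA.range) ⊕ (G ⧸ iB.range) → Prop)
    (h : ∀ e, p (Sum.inl (cosetProj (MonoidHom.range_le_of_comp_eq hA) e)) ↔
      p (Sum.inr (cosetProj (MonoidHom.range_le_of_comp_eq hB) e))) (v w) (hv : p v) : p w := by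
  -- Right multiplication does not act on cosets, hence the quantifier over representatives `x`. A
  -- factor from `A` leaves the coset alone, while for `b` in `B` the edges at `x` and `x * b` share
  -- their `B`-vertex.
  have key : ∀ g : G, ∀ x : G, p (Sum.inl ((x * g : G) : G ⧸ iA.range)) ↔
      p (Sum.inl (x : G ⧸ iA.range)) :=
    hG.group_closure_eq_top
      { carrier := {g | ∀ x : G, p (Sum.inl ((x * g : G) : G ⧸ iA.range)) ↔
          p (Sum.inl (x : G ⧸ iA.range))}
        one_mem' := fun x => by rw [mul_one]
        mul_mem' := fun {g g'} hg hg' x => by rw [← mul_assoc, hg', hg]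
        inv_mem' := fun {g} hg x => by rw [← hg, inv_mul_cancel_right] }
      (fun a x => by rw [QuotientGroup.mk_mul_of_mem (s := iA.range) _ ⟨a, rfl⟩])
      (fun b x => by
        have h1 := h ((x * iB b : G) : G ⧸ iC.range)
        have h2 := h (x : G ⧸ iC.range)
        rw [cosetProj_mk, cosetProj_mk] at h1 h2
        rw [QuotientGroup.mk_mul_of_mem (s := iB.range) _ ⟨b, rfl⟩] at h1
        exact h1.trans h2.symm)
  have key' : ∀ v, p v ↔ p (Sum.inl ((1 : G) : G ⧸ iA.range)) := by
    rintro (v | v)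
    · induction v using QuotientGroup.induction_on with
      | H g => rw [← one_mul g, key]
    · induction v using QuotientGroup.induction_on with
      | H g => rw [← one_mul g, ← key g]; exact (h ((1 * g : G) : G ⧸ iC.range)).symm
  exact (key' w).2 ((key' v).1 hv)

include hG in
/-- The subgraph of the Bass-Serre tree of the points fixed by a subgroup is connected. -/
theorem CategoryTheory.IsPushout.coset_fixed_connected (H : Subgroup G) {X : Type*}
    (f : (G ⧸ iA.range) ⊕ (G ⧸ iB.range) → X)
    (hf : ∀ e, (∀ h ∈ H, h • e = e) →
      f (Sum.inl (cosetProj (MonoidHom.range_le_of_comp_eq hA) e)) =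
      f (Sum.inr (cosetProj (MonoidHom.range_le_of_comp_eq hB) e)))
    {v w : (G ⧸ iA.range) ⊕ (G ⧸ iB.range)} (hv : ∀ h ∈ H, h • v = v) (hw : ∀ h ∈ H, h • w = w) :
    f v = f w := by
  classical
  -- Splitting the indicator function of `e₀` gives a vertex function that jumps along `e₀` only.
  -- Coefficients modulo 2 are chosen so that vanishing or not of its value is a two-sided cut.
  have hex : ∀ e₀, ∃ φ : (G ⧸ iA.range) ⊕ (G ⧸ iB.range) → ULift.{u} (ZMod 2), ∀ e,
      ((if e = e₀ then 1 else 0 : ULift.{u} (ZMod 2))) =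
        φ (Sum.inl (cosetProj (MonoidHom.range_le_of_comp_eq hA) e)) -
        φ (Sum.inr (cosetProj (MonoidHom.range_le_of_comp_eq hB) e)) := fun e₀ => by
    obtain ⟨a, b, hab⟩ := hG.exists_coset_sub hA hB fun e =>
      (if e = e₀ then 1 else 0 : ULift.{u} (ZMod 2))
    exact ⟨Sum.elim a b, hab⟩
  choose φ hφ using hex
  refine eq_of_forall_fixed_edge (H := H) (E := G ⧸ iC.range)
    (s := fun e => Sum.inl (cosetProj (MonoidHom.range_le_of_comp_eq hA) e))
    (t := fun e => Sum.inr (cosetProj (MonoidHom.range_le_of_comp_eq hB) e))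
    (φ := fun e v => decide (φ e v = 0))
    (fun h e => congrArg Sum.inl (map_smul _ (h : G) e))
    (fun h e => congrArg Sum.inr (map_smul _ (h : G) e))
    (hG.coset_connected hA hB) (fun e => ?_) (fun e e' he => ?_) f
    (fun e he => hf e fun h hh => he ⟨h, hh⟩) (fun h => hv h h.2) (fun h => hw h h.2)
  · have := hφ e e
    rw [if_pos rfl] at this
    generalize φ e _ = x at *
    generalize φ e _ = y at *
    rcases x with ⟨x⟩
    rcases y with ⟨y⟩
    replace this : 1 = x - y := congrArg ULift.down this
    change decide (ULift.up x = ULift.up 0) ≠ decide (ULift.up y = ULift.up 0)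
    simp only [ULift.up_inj]
    revert this
    revert x y
    decide
  · have := hφ e e'
    rw [if_neg he] at this
    simp only [sub_eq_zero.1 this.symm]

end Amalgam

/-! ### Kan extension from a category of elements, and injectives -/

namespace CategoryTheory

open Limits

universe v v'

section

variable {C : Type u} [Category.{v} C] (P : C ⥤ Type u) {D : Type*} [Category* D]
  [HasCoproducts.{u} D]

namespace CategoryOfElements

variable {P} in
-- The summand depends on the element, so an equality of elements cannot be rewritten inside a
-- composite; this form absorbs the transport.
lemma map_comp_ι_congr (N : P.Elements ⥤ D) {c c' : C} {f g : c ⟶ c'} (hfg : f = g) {x : P.obj c}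
    {y z : P.obj c'} (hy : P.map f x = y) (hz : P.map g x = z) :
    N.map (homMk (P.elementsMk c x) (P.elementsMk c' y) f hy) ≫
        Limits.Sigma.ι (fun w : P.obj c' => N.obj (P.elementsMk c' w)) y =
      N.map (homMk (P.elementsMk c x) (P.elementsMk c' z) g hz) ≫
        Limits.Sigma.ι (fun w : P.obj c' => N.obj (P.elementsMk c' w)) z := by
  subst hfg hy hz
  rfl

/-- The left Kan extension along the projection from a category of elements: the coproduct of the
values over the fibres. -/
noncomputable def sigmaObj (N : P.Elements ⥤ D) : C ⥤ D where
  obj c := ∐ fun x : P.obj c => N.obj (P.elementsMk c x)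
  map {c c'} f := Limits.Sigma.desc fun x =>
    N.map (homMk (P.elementsMk c x) (P.elementsMk c' (P.map f x)) f rfl) ≫
    Limits.Sigma.ι (fun x : P.obj c' => N.obj (P.elementsMk c' x)) (P.map f x)
  map_id c := by
    refine Limits.Sigma.hom_ext _ _ fun x => ?_
    rw [Limits.Sigma.ι_desc, Category.comp_id,
      map_comp_ι_congr N rfl rfl (hz := show P.map (𝟙 c) x = x by simp)]
    exact (congrArg (· ≫ _) (N.map_id _)).trans (Category.id_comp _)
  map_comp {c c' c''} f g := by
    refine Limits.Sigma.hom_ext _ _ fun x => ?_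
    rw [Limits.Sigma.ι_desc, Limits.Sigma.ι_desc_assoc, Category.assoc, Limits.Sigma.ι_desc]
    have h : P.map (f ≫ g) x = P.map g (P.map f x) := by simp
    rw [map_comp_ι_congr N rfl rfl h]
    exact (congrArg (· ≫ _) (N.map_comp (homMk (P.elementsMk c x) (P.elementsMk c' (P.map f x)) f
      rfl) (homMk _ (P.elementsMk c'' (P.map g (P.map f x))) g rfl))).trans (Category.assoc _ _ _)

variable {P} in
/-- The inclusion of a summand. -/
noncomputable def sigmaι (N : P.Elements ⥤ D) (x : P.Elements) :
    N.obj x ⟶ (sigmaObj P N).obj x.1 :=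
  Limits.Sigma.ι (fun z : P.obj x.1 => N.obj ⟨x.1, z⟩) x.2

variable {P} in
lemma sigma_hom_ext {N : P.Elements ⥤ D} {c : C} {d : D} {f g : (sigmaObj P N).obj c ⟶ d}
    (h : ∀ x : P.obj c, sigmaι N (P.elementsMk c x) ≫ f = sigmaι N (P.elementsMk c x) ≫ g) :
    f = g :=
  Limits.Sigma.hom_ext _ _ h

variable {P} in
/-- The morphism from a coproduct over a fibre given by a family of morphisms. -/
noncomputable def sigmaDesc {N : P.Elements ⥤ D} {c : C} {d : D}
    (k : ∀ x : P.obj c, N.obj (P.elementsMk c x) ⟶ d) : (sigmaObj P N).obj c ⟶ d :=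
  Limits.Sigma.desc k

variable {P} in
lemma sigmaι_sigmaDesc {N : P.Elements ⥤ D} {c : C} {d : D}
    (k : ∀ x : P.obj c, N.obj (P.elementsMk c x) ⟶ d) (x : P.obj c) :
    sigmaι N (P.elementsMk c x) ≫ sigmaDesc k = k x :=
  Limits.Sigma.ι_desc k x

variable {P} in
lemma sigmaι_sigmaDesc_assoc {N : P.Elements ⥤ D} {c : C} {d : D}
    (k : ∀ x : P.obj c, N.obj (P.elementsMk c x) ⟶ d) (x : P.obj c) {d' : D} (h : d ⟶ d') :
    sigmaι N (P.elementsMk c x) ≫ sigmaDesc k ≫ h = k x ≫ h := by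
  rw [← Category.assoc, sigmaι_sigmaDesc]

variable {P} in
lemma sigmaι_map (N : P.Elements ⥤ D) {x y : P.Elements} (f : x ⟶ y) :
    sigmaι N x ≫ (sigmaObj P N).map f.1 = N.map f ≫ sigmaι N y := by
  obtain ⟨c, x⟩ := x
  obtain ⟨c', y⟩ := y
  obtain ⟨f, h⟩ := f
  change c ⟶ c' at f
  change P.map f x = y at h
  subst h
  exact Limits.Sigma.ι_desc _ _

variable {P} in
lemma sigmaι_map_assoc (N : P.Elements ⥤ D) {x y : P.Elements} (f : x ⟶ y) {d : D}
    (h : (sigmaObj P N).obj y.1 ⟶ d) :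
    sigmaι N x ≫ (sigmaObj P N).map f.1 ≫ h = N.map f ≫ sigmaι N y ≫ h :=
  (Category.assoc _ _ _).symm.trans
    ((congrArg (· ≫ h) (sigmaι_map N f)).trans (Category.assoc _ _ _))

/-- The morphisms induced on coproducts of values over the fibres. -/
noncomputable def sigmaMap {N N' : P.Elements ⥤ D} (τ : N ⟶ N') : sigmaObj P N ⟶ sigmaObj P N' where
  app c := Limits.Sigma.map fun x => τ.app (P.elementsMk c x)
  naturality c c' f := by
    have h (c : C) (x : P.obj c) : sigmaι N (P.elementsMk c x) ≫
        (Limits.Sigma.map fun x => τ.app (P.elementsMk c x) :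
          (sigmaObj P N).obj c ⟶ (sigmaObj P N').obj c) =
          τ.app (P.elementsMk c x) ≫ sigmaι N' (P.elementsMk c x) := Limits.Sigma.ι_map _ _
    refine sigma_hom_ext fun x => ?_
    let g : P.elementsMk c x ⟶ P.elementsMk c' (P.map f x) := homMk _ _ f rfl
    calc _ = N.map g ≫ sigmaι N _ ≫ _ := sigmaι_map_assoc N g _
      _ = N.map g ≫ τ.app _ ≫ sigmaι N' _ := congrArg (_ ≫ ·) (h _ _)
      _ = τ.app (P.elementsMk c x) ≫ N'.map g ≫ sigmaι N' _ := τ.naturality_assoc _ _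
      _ = τ.app (P.elementsMk c x) ≫ sigmaι N' _ ≫ (sigmaObj P N').map f :=
        congrArg (_ ≫ ·) (sigmaι_map N' g).symm
      _ = _ := (Category.assoc _ _ _).symm
      _ = _ := (congrArg (· ≫ _) (h c x).symm).trans (Category.assoc _ _ _)

variable {P} in
lemma sigmaι_sigmaMap_app {N N' : P.Elements ⥤ D} (τ : N ⟶ N') (c : C) (x : P.obj c) :
    sigmaι N (P.elementsMk c x) ≫ (sigmaMap P τ).app c =
      τ.app (P.elementsMk c x) ≫ sigmaι N' (P.elementsMk c x) :=
  Limits.Sigma.ι_map (fun x => τ.app (P.elementsMk c x)) x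

variable {P} in
lemma sigmaι_sigmaMap_app_assoc {N N' : P.Elements ⥤ D} (τ : N ⟶ N') (c : C) (x : P.obj c) {d : D}
    (h : (sigmaObj P N').obj c ⟶ d) :
    sigmaι N (P.elementsMk c x) ≫ (sigmaMap P τ).app c ≫ h =
      τ.app (P.elementsMk c x) ≫ sigmaι N' (P.elementsMk c x) ≫ h :=
  (Category.assoc _ _ _).symm.trans
    ((congrArg (· ≫ h) (sigmaι_sigmaMap_app τ c x)).trans (Category.assoc _ _ _))

/-- The functoriality of `sigmaObj`. -/
noncomputable def sigma : (P.Elements ⥤ D) ⥤ C ⥤ D where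
  obj N := sigmaObj P N
  map τ := sigmaMap P τ
  map_id N := by
    ext c : 2
    exact Limits.Sigma.map_id (f := fun x => N.obj (P.elementsMk c x))
  map_comp τ τ' := by
    ext c : 2
    refine sigma_hom_ext fun x => ?_
    calc _ = (τ.app _ ≫ τ'.app _) ≫ sigmaι _ _ := sigmaι_sigmaMap_app (τ ≫ τ') c x
      _ = τ.app _ ≫ τ'.app _ ≫ sigmaι _ _ := Category.assoc _ _ _
      _ = τ.app _ ≫ sigmaι _ _ ≫ (sigmaMap P τ').app c :=
        congrArg (_ ≫ ·) (sigmaι_sigmaMap_app τ' c x).symm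
      _ = _ := (sigmaι_sigmaMap_app_assoc τ c x _).symm

/-- The functor `sigma` is left adjoint to the restriction along the projection. -/
noncomputable def sigmaAdjunction : sigma P (D := D) ⊣ (Functor.whiskeringLeft _ _ D).obj (π P) :=
  Adjunction.mkOfHomEquiv
    { homEquiv N M :=
        { toFun τ :=
            { app x := sigmaι N x ≫ τ.app x.1
              naturality x y f :=
                (sigmaι_map_assoc N f (τ.app y.1)).symm.trans
                  ((congrArg (_ ≫ ·) (τ.naturality f.1)).trans (Category.assoc _ _ _).symm) }
          invFun τ :=
            { app c := sigmaDesc (d := M.obj c) fun x => τ.app (P.elementsMk c x)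
              naturality c c' f := sigma_hom_ext fun x => by
                let g : P.elementsMk c x ⟶ P.elementsMk c' (P.map f x) := homMk _ _ f rfl
                refine (sigmaι_map_assoc N g _).trans ?_
                refine (congrArg (_ ≫ ·) (sigmaι_sigmaDesc (d := M.obj c')
                  (fun x => τ.app (P.elementsMk c' x)) (P.map f x))).trans ?_
                exact (τ.naturality g).trans (sigmaι_sigmaDesc_assoc (d := M.obj c)
                  (fun x => τ.app (P.elementsMk c x)) x _).symm }
          left_inv τ := by
            ext c : 2
            exact sigma_hom_ext fun x => sigmaι_sigmaDesc _ _
          right_inv τ := by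
            ext x : 2
            exact sigmaι_sigmaDesc (N := N) (d := M.obj x.1)
              (fun z => τ.app (P.elementsMk x.1 z)) x.2 }
      homEquiv_naturality_left_symm := fun {N N' M} τ σ => by
        ext c : 2
        refine sigma_hom_ext fun x => ?_
        refine (sigmaι_sigmaDesc (d := M.obj c) (fun x => (τ ≫ σ).app (P.elementsMk c x)) x).trans
          (Eq.trans ?_ (sigmaι_sigmaMap_app_assoc τ c x _).symm)
        exact congrArg (τ.app (P.elementsMk c x) ≫ ·) (sigmaι_sigmaDesc (d := M.obj c)
          (fun x => σ.app (P.elementsMk c x)) x).symm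
      homEquiv_naturality_right := fun {N M M'} τ σ => by
        ext x : 2
        exact (Category.assoc _ _ _).symm }

/-- This is where AB4 enters. It makes `sigma` preserve monomorphisms, so that its right adjoint
preserves injectives. -/
lemma mono_sigma_map {β : Type u} [Abelian D] [AB4OfSize.{u} D] {f g : β → D}
    (p : ∀ b, f b ⟶ g b) [∀ b, Mono (p b)] : Mono (Limits.Sigma.map p) := by
  have (x : Discrete β) : Mono ((Discrete.natTrans
      (F := Discrete.functor f) (G := Discrete.functor g) fun x => p x.as).app x) :=
    inferInstanceAs (Mono (p x.as))
  have : Mono (Discrete.natTrans (F := Discrete.functor f) (G := Discrete.functor g)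
    fun x => p x.as) := NatTrans.mono_of_mono_app _
  exact inferInstanceAs (Mono (colim.map (Discrete.natTrans (F := Discrete.functor f)
    (G := Discrete.functor g) fun x => p x.as)))

instance sigma_preservesMonomorphisms [Abelian D] [AB4OfSize.{u} D] :
    (sigma P (D := D)).PreservesMonomorphisms where
  preserves {N N'} τ hτ := by
    have (x : P.Elements) : Mono (τ.app x) := (NatTrans.mono_iff_mono_app τ).1 hτ x
    have (c : C) : Mono (((sigma P).map τ).app c) :=
      mono_sigma_map (p := fun x : P.obj c => τ.app (P.elementsMk c x))
    exact NatTrans.mono_of_mono_app _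

instance whiskeringLeft_π_preservesInjectiveObjects [Abelian D] [AB4OfSize.{u} D] :
    ((Functor.whiskeringLeft _ _ D).obj (π P)).PreservesInjectiveObjects :=
  Functor.preservesInjectiveObjects_of_adjunction_of_preservesMonomorphisms (sigmaAdjunction P)

/-- A compatible family of elements over a category equivalent to the category of elements of `P`
extends to all elements of `P`. -/
lemma exists_extend_of_full_of_essSurj {P : C ⥤ Type u} {E : Type*} [Category* E] (e : E ⥤ P.Elements)
    [e.Full] [e.EssSurj] {M : C ⥤ Type u} (m : ∀ d, M.obj (e.obj d).1)
    (hm : ∀ {d d'} (g : d ⟶ d'), M.map (e.map g).1 (m d) = m d') :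
    ∃ u : ∀ x : P.Elements, M.obj x.1, (∀ {x y : P.Elements} (f : x ⟶ y), M.map f.1 (u x) = u y) ∧
      ∀ d, u (e.obj d) = m d := by
  -- Fullness gives compatibility along every morphism between objects in the image, so values
  -- transported from a chosen preimage do not depend on the choice.
  have key : ∀ {d d'} (f : e.obj d ⟶ e.obj d'), M.map f.1 (m d) = m d' := fun f => by
    obtain ⟨g, rfl⟩ := e.map_surjective f
    exact hm g
  refine ⟨fun x => M.map (e.objObjPreimageIso x).hom.1 (m _), fun {x y} f => ?_, fun d => key _⟩
  have := key ((e.objObjPreimageIso x).hom ≫ f ≫ (e.objObjPreimageIso y).inv)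
  refine Eq.trans ?_ (congrArg (M.map (e.objObjPreimageIso y).hom.1) this)
  have h : f.1 = (f ≫ (e.objObjPreimageIso y).inv).1 ≫ (e.objObjPreimageIso y).hom.1 := by
    rw [← comp_val, Category.assoc, Iso.inv_hom_id, Category.comp_id]
  rw [h]
  simp only [comp_val, Functor.map_comp_apply]

end CategoryOfElements

end

/-! ### Elementwise criterion for short exactness -/

/-- A sequence of functors to abelian groups with middle term a biproduct is short exact if it is
so elementwise. -/
lemma shortExact_biprod_of_apply {C : Type u} [Category.{v} C] {P Q₁ Q₂ R : C ⥤ AddCommGrpCat.{u}}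
    (q₁ : P ⟶ Q₁) (q₂ : P ⟶ Q₂) (p₁ : Q₁ ⟶ R) (p₂ : Q₂ ⟶ R)
    (h : biprod.lift q₁ (-q₂) ≫ biprod.desc p₁ p₂ = 0)
    (inj : ∀ X (z : P.obj X), q₁.app X z = 0 → q₂.app X z = 0 → z = 0)
    (exact : ∀ X (a : Q₁.obj X) (b : Q₂.obj X), p₁.app X a + p₂.app X b = 0 →
      ∃ z : P.obj X, q₁.app X z = a ∧ -q₂.app X z = b)
    (surj : ∀ X (r : R.obj X), ∃ a b, p₁.app X a + p₂.app X b = r) :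
    (ShortComplex.mk _ _ h).ShortExact := by
  have happ {F F' F'' : C ⥤ AddCommGrpCat.{u}} {f : F ⟶ F'} {g : F' ⟶ F''} {k : F ⟶ F''}
      (e : f ≫ g = k) (X : C) (x : F.obj X) : g.app X (f.app X x) = k.app X x := by
    rw [← e]
    rfl
  have hneg (X : C) (z : P.obj X) : (-q₂).app X z = -q₂.app X z := rfl
  have htotal (X : C) (y : (Q₁ ⊞ Q₂ : C ⥤ AddCommGrpCat.{u}).obj X) :
      (biprod.inl : Q₁ ⟶ Q₁ ⊞ Q₂).app X ((biprod.fst : Q₁ ⊞ Q₂ ⟶ Q₁).app X y) +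
        (biprod.inr : Q₂ ⟶ Q₁ ⊞ Q₂).app X ((biprod.snd : Q₁ ⊞ Q₂ ⟶ Q₂).app X y) = y := by
    have := congrArg (fun f : Q₁ ⊞ Q₂ ⟶ Q₁ ⊞ Q₂ => f.app X y) (biprod.total (X := Q₁) (Y := Q₂))
    exact this
  have hdesc (X : C) (y : (Q₁ ⊞ Q₂ : C ⥤ AddCommGrpCat.{u}).obj X) :
      (biprod.desc p₁ p₂).app X y = p₁.app X ((biprod.fst : Q₁ ⊞ Q₂ ⟶ Q₁).app X y) +
        p₂.app X ((biprod.snd : Q₁ ⊞ Q₂ ⟶ Q₂).app X y) := by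
    conv_lhs => rw [← htotal X y, map_add]
    rw [happ (biprod.inl_desc p₁ p₂), happ (biprod.inr_desc p₁ p₂)]
  have hlift (X : C) (z : P.obj X) : (biprod.lift q₁ (-q₂)).app X z =
      (biprod.inl : Q₁ ⟶ Q₁ ⊞ Q₂).app X (q₁.app X z) +
        (biprod.inr : Q₂ ⟶ Q₁ ⊞ Q₂).app X (-q₂.app X z) := by
    conv_lhs => rw [← htotal X ((biprod.lift q₁ (-q₂)).app X z)]
    rw [happ (biprod.lift_fst q₁ (-q₂)), happ (biprod.lift_snd q₁ (-q₂)), hneg]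
  have hm : Mono (biprod.lift q₁ (-q₂)) := by
    have (X : C) : Mono ((biprod.lift q₁ (-q₂)).app X) := by
      rw [AddCommGrpCat.mono_iff_injective, injective_iff_map_eq_zero]
      intro z hz
      refine inj X z ?_ ?_
      · rw [← happ (biprod.lift_fst q₁ (-q₂)), hz, map_zero]
      · rw [← neg_eq_zero, ← hneg, ← happ (biprod.lift_snd q₁ (-q₂)), hz, map_zero]
    exact NatTrans.mono_of_mono_app _
  have he : Epi (biprod.desc p₁ p₂) := by
    have (X : C) : Epi ((biprod.desc p₁ p₂).app X) := by
      rw [AddCommGrpCat.epi_iff_surjective]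
      intro r
      obtain ⟨a, b, hab⟩ := surj X r
      refine ⟨(biprod.inl : Q₁ ⟶ Q₁ ⊞ Q₂).app X a + (biprod.inr : Q₂ ⟶ Q₁ ⊞ Q₂).app X b, ?_⟩
      rw [map_add, happ (biprod.inl_desc p₁ p₂), happ (biprod.inr_desc p₁ p₂), hab]
    exact NatTrans.epi_of_epi_app _
  refine { exact := ?_, mono_f := hm, epi_g := he }
  -- Evaluation functors commute with homology, so exactness can be tested objectwise.
  rw [ShortComplex.exact_iff_isZero_homology]
  refine Functor.isZero _ fun X => ?_
  refine IsZero.of_iso ?_ (ShortComplex.mapHomologyIso _ ((evaluation _ _).obj X)).symm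
  rw [← ShortComplex.exact_iff_isZero_homology]
  rw [ShortComplex.ab_exact_iff]
  intro y hy
  obtain ⟨z, hz1, hz2⟩ := exact X _ _ ((hdesc X y).symm.trans hy)
  refine ⟨z, (hlift X z).trans ?_⟩
  rw [hz1, hz2]
  exact htotal X y

end CategoryTheory

/-! ### Permutation modules -/

section PermutationModules

variable {G : Type u} [Group G] (F : SubgroupFamily G)

/-- The presheaf `G/H ↦ Hom_G(G/H, T) = T^H` on the orbit category represented by a `G`-set. -/
def orbitHoms (T : Type u) [MulAction G T] : (OrbitCat F)ᵒᵖ ⥤ Type u where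
  obj X := (G ⧸ X.unop.subgroup) →[G] T
  map {X Y} φ := ↾fun p : (G ⧸ X.unop.subgroup) →[G] T =>
    p.comp (show (G ⧸ Y.unop.subgroup) →[G] (G ⧸ X.unop.subgroup) from φ.unop)

/-- The module `G/H ↦ ℤ[T^H]` attached to a `G`-set `T`. -/
noncomputable def permMod (T : Type u) [MulAction G T] : BredonMod F :=
  orbitHoms F T ⋙ AddCommGrpCat.free

namespace permMod

variable {F} {T T' : Type u} [MulAction G T] [MulAction G T']

/-- The basis element of `ℤ[T^H]` attached to a `G`-map `G/H → T`. -/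
noncomputable def of {X : (OrbitCat F)ᵒᵖ} (p : (orbitHoms F T).obj X) : (permMod F T).obj X :=
  FreeAbelianGroup.of p

theorem map_of {X Y : (OrbitCat F)ᵒᵖ} (φ : X ⟶ Y) (p : (orbitHoms F T).obj X) :
    (permMod F T).map φ (of p) = of ((orbitHoms F T).map φ p) :=
  FreeAbelianGroup.map_of_apply _

/-- The homomorphism from `ℤ[T^H]` given by the images of the basis elements. -/
noncomputable def lift {X : (OrbitCat F)ᵒᵖ} {D : Type u} [AddCommGroup D]
    (u : (orbitHoms F T).obj X → D) : (permMod F T).obj X →+ D :=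
  FreeAbelianGroup.lift u

@[simp]
theorem lift_of {X : (OrbitCat F)ᵒᵖ} {D : Type u} [AddCommGroup D]
    (u : (orbitHoms F T).obj X → D) (p : (orbitHoms F T).obj X) :
    lift u (of p) = u p :=
  FreeAbelianGroup.lift_apply_of _ _

theorem addMonoidHom_ext {X : (OrbitCat F)ᵒᵖ} {D : Type u} [AddCommGroup D]
    {u v : (permMod F T).obj X →+ D} (h : ∀ p, u (of p) = v (of p)) : u = v :=
  FreeAbelianGroup.lift_ext _ _ h

theorem hom_ext {M : BredonMod F} {u v : permMod F T ⟶ M}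
    (h : ∀ X (p : (orbitHoms F T).obj X), u.app X (of p) = v.app X (of p)) : u = v := by
  ext X : 2
  exact AddCommGrpCat.hom_ext (addMonoidHom_ext (h X))

theorem map_app_of_eq {M : BredonMod F} (w : permMod F T ⟶ M) {X Y : (OrbitCat F)ᵒᵖ} (φ : X ⟶ Y)
    {p : (orbitHoms F T).obj X} {q : (orbitHoms F T).obj Y} (h : (orbitHoms F T).map φ p = q) :
    M.map φ (w.app X (of p)) = w.app Y (of q) := by
  rw [← h, ← map_of]
  exact (NatTrans.naturality_apply w φ _).symm

/-- The morphism from `ℤ[T^?]` given by compatible images of the basis elements. -/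
noncomputable def desc {M : BredonMod F} (u : ∀ X, (orbitHoms F T).obj X → M.obj X)
    (hu : ∀ {X Y} (φ : X ⟶ Y) p, M.map φ (u X p) = u Y ((orbitHoms F T).map φ p)) :
    permMod F T ⟶ M where
  app X := AddCommGrpCat.ofHom (lift (u X))
  naturality X Y φ := by
    refine AddCommGrpCat.hom_ext (addMonoidHom_ext fun p => ?_)
    change lift (u Y) ((permMod F T).map φ (of p)) = M.map φ (lift (u X) (of p))
    rw [map_of, lift_of, lift_of, hu]

@[simp]
theorem desc_app_of {M : BredonMod F} (u : ∀ X, (orbitHoms F T).obj X → M.obj X)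
    (hu : ∀ {X Y} (φ : X ⟶ Y) p, M.map φ (u X p) = u Y ((orbitHoms F T).map φ p))
    (X : (OrbitCat F)ᵒᵖ) (p : (orbitHoms F T).obj X) :
    (desc u hu).app X (of p) = u X p :=
  lift_of _ _

/-- The composition of a point of `orbitHoms F T` with a map of `G`-sets. -/
def _root_.orbitHoms.comp (t : T →[G] T') {X : (OrbitCat F)ᵒᵖ} (p : (orbitHoms F T).obj X) :
    (orbitHoms F T').obj X :=
  MulActionHom.comp t p

variable (F) in
/-- The morphism of modules induced by a map of `G`-sets. -/
noncomputable def map (t : T →[G] T') : permMod F T ⟶ permMod F T' :=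
  desc (fun _ p => of (orbitHoms.comp t p)) fun φ _ => map_of φ _

@[simp]
theorem map_app_of (t : T →[G] T') (X : (OrbitCat F)ᵒᵖ) (p : (orbitHoms F T).obj X) :
    (map F t).app X (of p) = of (orbitHoms.comp t p) :=
  lift_of _ _

variable (F T) in
/-- The augmentation. -/
noncomputable def aug : permMod F T ⟶ trivialMod F :=
  desc (fun _ _ => (⟨1⟩ : ULift.{u} ℤ)) fun _ _ => rfl

@[simp]
theorem aug_app_of (X : (OrbitCat F)ᵒᵖ) (p : (orbitHoms F T).obj X) :
    (aug F T).app X (of p) = (⟨1⟩ : ULift.{u} ℤ) :=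
  lift_of (D := ULift.{u} ℤ) _ _

end permMod

end PermutationModules

theorem trivialMod_hom_ext {G : Type u} [Group G] {F : SubgroupFamily G} {M : BredonMod F}
    {u v : trivialMod F ⟶ M}
    (h : ∀ X, u.app X (⟨1⟩ : ULift.{u} ℤ) = v.app X (⟨1⟩ : ULift.{u} ℤ)) : u = v := by
  ext X : 2
  refine AddCommGrpCat.hom_ext ?_
  have key : ((u.app X).hom.comp AddEquiv.ulift.symm.toAddMonoidHom : ℤ →+ M.obj X) =
      (v.app X).hom.comp AddEquiv.ulift.symm.toAddMonoidHom := AddMonoidHom.ext_int (h X)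
  refine AddMonoidHom.ext fun n => ?_
  exact DFunLike.congr_fun key n.down

/-! ### Orbits of `S` as orbits of `G` over `G/f(S)` -/

section Induction

variable {S G : Type u} [Group S] [Group G] (F : SubgroupFamily G) (f : S →* G)

/-- The functor `S/K ↦ (G/f(K) → G/f(S))` from the orbit category of `S` to the orbits of `G` over
`G/f(S)`. -/
def orbitElements :
    (OrbitCat (F.restrict f))ᵒᵖ ⥤ (orbitHoms F (G ⧸ f.range)).Elements where
  obj X := (orbitHoms F (G ⧸ f.range)).elementsMk (.op ((orbitFunctor f (F.map_mem f)).obj X.unop))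
    (cosetProj (Subgroup.map_le_range f X.unop.subgroup))
  map {X Y} φ := CategoryOfElements.homMk _ _ ((orbitFunctor f (F.map_mem f)).map φ.unop).op (by
    refine MulActionHom.ext fun x => ?_
    induction x using QuotientGroup.induction_on with
    | H z =>
      change cosetProj (Subgroup.map_le_range f X.unop.subgroup) (inducedMap f
        (show (S ⧸ Y.unop.subgroup) →[S] (S ⧸ X.unop.subgroup) from
        φ.unop) (z : G ⧸ _)) = (z : G ⧸ f.range)
      rw [inducedMap_mk]
      generalize (show (S ⧸ Y.unop.subgroup) →[S] (S ⧸ X.unop.subgroup) from φ.unop)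
        ((1 : S) : S ⧸ Y.unop.subgroup) = y
      induction y using QuotientGroup.induction_on with
      | H w => exact QuotientGroup.mk_mul_of_mem _ ⟨w, rfl⟩)
  map_id X := Subtype.ext (congrArg Quiver.Hom.op ((orbitFunctor f (F.map_mem f)).map_id X.unop))
  map_comp φ ψ := Subtype.ext
    (congrArg Quiver.Hom.op ((orbitFunctor f (F.map_mem f)).map_comp ψ.unop φ.unop))

variable {f} (hf : Function.Injective f)

include hf in
theorem cosetMap_injective (H : Subgroup S) : Function.Injective (cosetMap f H) := by
  intro x y
  induction x using QuotientGroup.induction_on with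
  | H a =>
  induction y using QuotientGroup.induction_on with
  | H b =>
    intro h
    obtain ⟨s, hs, hs'⟩ := QuotientGroup.eq.1 (show ((f a : G) : G ⧸ H.map f) = (f b : G) from h)
    rw [← map_inv, ← map_mul] at hs'
    rw [QuotientGroup.eq, ← hf hs']
    exact hs

theorem exists_cosetMap_eq (H : Subgroup S) (x : G ⧸ H.map f)
    (hx : cosetProj (Subgroup.map_le_range f H) x = ((1 : G) : G ⧸ f.range)) :
    ∃ y, cosetMap f H y = x := by
  induction x using QuotientGroup.induction_on with
  | H g =>
    have h : ((1 : G) : G ⧸ f.range) = (g : G ⧸ f.range) := hx.symm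
    rw [QuotientGroup.eq] at h
    obtain ⟨s, hs⟩ := h
    exact ⟨(s : S ⧸ H), by rw [inv_one, one_mul] at hs; rw [← hs]; rfl⟩

theorem cosetProj_cosetMap (H : Subgroup S) (y : S ⧸ H) :
    cosetProj (Subgroup.map_le_range f H) (cosetMap f H y) = ((1 : G) : G ⧸ f.range) := by
  induction y using QuotientGroup.induction_on with
  | H s =>
    change ((f s : G) : G ⧸ f.range) = ((1 : G) : G ⧸ f.range)
    rw [QuotientGroup.eq]
    exact ⟨s⁻¹, by simp⟩

include hf in
theorem orbitElements_faithful : (orbitElements F f).Faithful where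
  map_injective {X Y} φ ψ h := by
    have h1 : inducedMap f (show (S ⧸ Y.unop.subgroup) →[S] (S ⧸ X.unop.subgroup) from φ.unop) =
        inducedMap f (show (S ⧸ Y.unop.subgroup) →[S] (S ⧸ X.unop.subgroup) from ψ.unop) :=
      congrArg (fun k => k.1.unop) h
    refine Quiver.Hom.unop_inj (MulActionHom.ext fun x => cosetMap_injective hf _ ?_)
    rw [← inducedMap_cosetMap, ← inducedMap_cosetMap, h1]

include hf in
-- The fibre of `G/f(H) → G/f(S)` over the base coset is `S/H`. A `G`-map over `G/f(S)` preserves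
-- this fibre and is determined by its restriction there.
theorem exists_inducedMap_eq {H K : Subgroup S} (k : (G ⧸ H.map f) →[G] (G ⧸ K.map f))
    (hk : ∀ x, cosetProj (Subgroup.map_le_range f K) (k x) =
      cosetProj (Subgroup.map_le_range f H) x) :
    ∃ φ : (S ⧸ H) →[S] (S ⧸ K), inducedMap f φ = k := by
  have h (x : S ⧸ H) : ∃ y : S ⧸ K, cosetMap f K y = k (cosetMap f H x) :=
    exists_cosetMap_eq K _ (by rw [hk, cosetProj_cosetMap])
  choose φ hφ using h
  refine ⟨⟨φ, fun s x => cosetMap_injective hf K ?_⟩, MulActionHom.ext fun x => ?_⟩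
  · rw [hφ, cosetMap_smul, map_smul]
    exact ((cosetMap_smul f K s (φ x)).trans (congrArg (f s • ·) (hφ x))).symm
  · induction x using QuotientGroup.induction_on with
    | H g =>
      rw [inducedMap_mk]
      change g • cosetMap f K (φ _) = _
      rw [hφ, ← map_smul]
      change k ((g * f 1 : G) : G ⧸ H.map f) = _
      rw [map_one, mul_one]

include hf in
theorem orbitElements_full : (orbitElements F f).Full where
  map_surjective {X Y} k := by
    obtain ⟨φ, hφ⟩ := exists_inducedMap_eq hf (H := Y.unop.subgroup) (K := X.unop.subgroup)
      k.1.unop (fun x => DFunLike.congr_fun (F := (G ⧸ _) →[G] (G ⧸ f.range)) k.2 x)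
    exact ⟨Quiver.Hom.op (show Y.unop ⟶ X.unop from φ),
      Subtype.ext (congrArg Quiver.Hom.op hφ)⟩

/-- The map `G/H → G/K`, `H ↦ gK`, for `g⁻¹Hg ≤ K`. -/
def cosetMulRight {H K : Subgroup G} (g : G) (h : ∀ x ∈ H, g⁻¹ * x * g ∈ K) :
    (G ⧸ H) →[G] (G ⧸ K) where
  toFun := Quotient.map' (· * g) fun a b hab => by
    rw [QuotientGroup.leftRel_apply] at hab ⊢
    simpa [mul_assoc] using h _ hab
  map_smul' x y := by
    induction y using QuotientGroup.induction_on with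
    | H z => exact congrArg (QuotientGroup.mk (s := K)) (mul_assoc x z g)

variable (f) in
theorem orbitElements_essSurj : (orbitElements F f).EssSurj where
  mem_essImage := by
    rintro ⟨⟨H, hH⟩, p⟩
    change (G ⧸ H) →[G] (G ⧸ f.range) at p
    obtain ⟨g, hg⟩ := QuotientGroup.mk_surjective (p ((1 : G) : G ⧸ H))
    have hp (x : G) : p (x : G ⧸ H) = ((x * g : G) : G ⧸ f.range) := by
      have := map_smul p x ((1 : G) : G ⧸ H)
      rw [← hg] at this
      rw [← mul_one x]
      exact this.trans (by rw [mul_one]; rfl)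
    have hrange : H.map (MulAut.conj g⁻¹).toMonoidHom ≤ f.range := by
      rintro _ ⟨x, hx, rfl⟩
      have h1 : ((x : G) : G ⧸ H) = ((1 : G) : G ⧸ H) := QuotientGroup.eq.2 (by simpa using hx)
      have h2 := hp x
      rw [h1, hp, one_mul, QuotientGroup.eq] at h2
      simpa [mul_assoc] using h2
    -- The base coset goes to `gf(S)`, which forces `g⁻¹Hg ≤ f(S)`. So `g⁻¹Hg` is the image of a
    -- subgroup `K` of `S`, and right multiplication by `g` identifies `G/H` with `G/f(K)` over
    -- `G/f(S)`.
    let K : Subgroup S := (H.map (MulAut.conj g⁻¹).toMonoidHom).comap f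
    have hK : K.map f = H.map (MulAut.conj g⁻¹).toMonoidHom :=
      Subgroup.map_comap_eq_self hrange
    have hKF : K ∈ F.restrict f := by
      change K.map f ∈ F
      rw [hK]
      exact F.conj_mem _ hH _
    let a : (G ⧸ H) →[G] (G ⧸ K.map f) := cosetMulRight g fun x hx => by
      rw [hK]
      exact ⟨x, hx, by simp⟩
    let b : (G ⧸ K.map f) →[G] (G ⧸ H) := cosetMulRight g⁻¹ fun x hx => by
      rw [hK] at hx
      obtain ⟨y, hy, rfl⟩ := hx
      simpa [mul_assoc] using hy
    let X : OrbitCat F := ⟨H, hH⟩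
    let Y : OrbitCat F := ⟨K.map f, hKF⟩
    let i : X ≅ Y :=
      { hom := a
        inv := b
        hom_inv_id := by
          refine MulActionHom.ext fun x => ?_
          induction x using QuotientGroup.induction_on with
          | H z => exact congrArg (QuotientGroup.mk (s := H)) (mul_inv_cancel_right z g)
        inv_hom_id := by
          refine MulActionHom.ext fun x => ?_
          induction x using QuotientGroup.induction_on with
          | H z => exact congrArg (QuotientGroup.mk (s := K.map f)) (inv_mul_cancel_right z g) }
    refine ⟨.op ⟨K, hKF⟩, ⟨CategoryOfElements.isoMk _ _ i.op ?_⟩⟩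
    refine MulActionHom.ext fun x => ?_
    induction x using QuotientGroup.induction_on with
    | H z => exact (hp z).symm

include hf in
theorem orbitElements_isEquivalence : (orbitElements F f).IsEquivalence :=
  { faithful := orbitElements_faithful F hf
    full := orbitElements_full F hf
    essSurj := orbitElements_essSurj F f }

include hf in
-- Restriction along `f` factors as restriction along the projection from the category of elements
-- followed by restriction along the equivalence `orbitElements`; both preserve injectives.
theorem resFunctor_preservesInjectiveObjects :
    (resFunctor f (F.map_mem f)).PreservesInjectiveObjects := by
  have := orbitElements_isEquivalence F hf
  exact inferInstanceAs ((Functor.whiskeringLeft _ _ AddCommGrpCat.{u}).obj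
    (CategoryOfElements.π (orbitHoms F (G ⧸ f.range))) ⋙
      (Functor.whiskeringLeft _ _ _).obj (orbitElements F f)).PreservesInjectiveObjects

variable (f)

/-- The point `G/f(K) → G/f(S)` of `orbitHoms F (G/f(S))`. -/
def orbitHoms.proj (X : (OrbitCat (F.restrict f))ᵒᵖ) :
    (orbitHoms F (G ⧸ f.range)).obj (.op ((orbitFunctor f (F.map_mem f)).obj X.unop)) :=
  cosetProj (Subgroup.map_le_range f X.unop.subgroup)

/-- The universal arrow from the trivial module to the restriction of `ℤ[G/f(S)^?]`. -/
noncomputable def trivialUnit : trivialMod (F.restrict f) ⟶ F.res f (permMod F (G ⧸ f.range)) where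
  app X := AddCommGrpCat.ofHom
    ((zmultiplesHom _ (permMod.of (orbitHoms.proj F f X))).comp AddEquiv.ulift.toAddMonoidHom)
  naturality X Y φ := by
    refine AddCommGrpCat.hom_ext (AddMonoidHom.ext fun n => ?_)
    change n.down • permMod.of (orbitHoms.proj F f Y) = (permMod F (G ⧸ f.range)).map
      ((orbitFunctor f (F.map_mem f)).map φ.unop).op (n.down • permMod.of (orbitHoms.proj F f X))
    rw [map_zsmul, permMod.map_of]
    exact congrArg (fun p => n.down • permMod.of p) ((orbitElements F f).map φ).2.symm

theorem trivialUnit_app_one (X : (OrbitCat (F.restrict f))ᵒᵖ) :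
    (trivialUnit F f).app X (⟨1⟩ : ULift.{u} ℤ) = permMod.of (orbitHoms.proj F f X) :=
  one_zsmul _

variable {f}

include hf in
-- A morphism from `ℤ[(G/f(S))^?]` to `M` is a compatible family of elements of `M` over the
-- category of elements. Through `orbitElements` this is the same as a compatible family over the
-- orbits of `S`, that is, a morphism from the trivial module to the restriction of `M`.
theorem trivialUnit_bijective (M : BredonMod F) :
    Function.Bijective fun u : permMod F (G ⧸ f.range) ⟶ M =>
      trivialUnit F f ≫ (resFunctor f (F.map_mem f)).map u := by
  have := orbitElements_full F hf
  have := orbitElements_essSurj F f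
  constructor
  · intro u v huv
    refine permMod.hom_ext fun X p => ?_
    let x := (orbitHoms F (G ⧸ f.range)).elementsMk X p
    let i := (orbitElements F f).objObjPreimageIso x
    have hi : (orbitHoms F (G ⧸ f.range)).map i.hom.1 (orbitHoms.proj F f _) = p := i.hom.2
    have key (w : permMod F (G ⧸ f.range) ⟶ M) : w.app X (permMod.of p) = M.map i.hom.1
        ((trivialUnit F f ≫ (resFunctor f (F.map_mem f)).map w).app _ (⟨1⟩ : ULift.{u} ℤ)) := by
      have h1 : (trivialUnit F f ≫ (resFunctor f (F.map_mem f)).map w).app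
          ((orbitElements F f).objPreimage x) (⟨1⟩ : ULift.{u} ℤ) =
            w.app _ (permMod.of (orbitHoms.proj F f _)) :=
        congrArg (w.app _) (trivialUnit_app_one F f _)
      exact ((congrArg (M.map i.hom.1) h1).trans (permMod.map_app_of_eq w i.hom.1 hi)).symm
    rw [key u, key v]
    exact congrArg (fun w => M.map i.hom.1 (w.app _ (⟨1⟩ : ULift.{u} ℤ))) huv
  · intro v
    have hv {X Y} (φ : X ⟶ Y) : M.map ((orbitElements F f).map φ).1
        (v.app X (⟨1⟩ : ULift.{u} ℤ)) = v.app Y (⟨1⟩ : ULift.{u} ℤ) :=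
      (congrArg (fun k => k.hom (⟨1⟩ : ULift.{u} ℤ)) (v.naturality φ)).symm
    obtain ⟨u, hu, hu'⟩ := CategoryOfElements.exists_extend_of_full_of_essSurj (orbitElements F f)
      (M := M ⋙ forget _) (fun X => v.app X (⟨1⟩ : ULift.{u} ℤ)) hv
    let u' (X) (p : (orbitHoms F (G ⧸ f.range)).obj X) : M.obj X :=
      u ((orbitHoms F (G ⧸ f.range)).elementsMk X p)
    have hu'' {X Y} (φ : X ⟶ Y) (p : (orbitHoms F (G ⧸ f.range)).obj X) :
        M.map φ (u' X p) = u' Y ((orbitHoms F (G ⧸ f.range)).map φ p) :=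
      hu (CategoryOfElements.homMk ((orbitHoms F (G ⧸ f.range)).elementsMk X p)
        ((orbitHoms F (G ⧸ f.range)).elementsMk Y ((orbitHoms F (G ⧸ f.range)).map φ p)) φ rfl)
    refine ⟨permMod.desc u' hu'', trivialMod_hom_ext fun X => ?_⟩
    have h1 : (trivialUnit F f ≫ (resFunctor f (F.map_mem f)).map (permMod.desc u' hu'')).app X
        (⟨1⟩ : ULift.{u} ℤ) = (permMod.desc u' hu'').app _ (permMod.of (orbitHoms.proj F f X)) :=
      congrArg ((permMod.desc u' hu'').app _) (trivialUnit_app_one F f X)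
    exact h1.trans ((permMod.desc_app_of u' hu'' _ _).trans (hu' X))

end Induction

/-! ### Chains on the fixed points of the tree -/

section Exactness

variable {A B C G : Type u} [Group A] [Group B] [Group C] [Group G]
  {φA : C →* A} {φB : C →* B} {iA : A →* G} {iB : B →* G} {iC : C →* G}
  (F : SubgroupFamily G)

theorem orbitHoms.ext {G : Type u} [Group G] {F : SubgroupFamily G} {T : Type u} [MulAction G T]
    {X : (OrbitCat F)ᵒᵖ} {p q : (G ⧸ X.unop.subgroup) →[G] T}
    (h : p ((1 : G) : G ⧸ X.unop.subgroup) = q ((1 : G) : G ⧸ X.unop.subgroup)) : p = q := by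
  refine MulActionHom.ext fun x => ?_
  induction x using QuotientGroup.induction_on with
  | H z =>
    have hz : (z : G ⧸ X.unop.subgroup) = z • ((1 : G) : G ⧸ X.unop.subgroup) :=
      congrArg (QuotientGroup.mk (s := X.unop.subgroup)) (mul_one z).symm
    rw [hz, map_smul, map_smul, h]

/-- The fixed point of the isotropy group attached to a point of `orbitHoms F T`. -/
def orbitHoms.eval {G : Type u} [Group G] {F : SubgroupFamily G} {T : Type u} [MulAction G T]
    {X : (OrbitCat F)ᵒᵖ} (p : (orbitHoms F T).obj X) : T :=
  (show (G ⧸ X.unop.subgroup) →[G] T from p) ((1 : G) : G ⧸ X.unop.subgroup)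

theorem orbitHoms.eval_injective {G : Type u} [Group G] {F : SubgroupFamily G} {T : Type u}
    [MulAction G T] {X : (OrbitCat F)ᵒᵖ} :
    Function.Injective (orbitHoms.eval : (orbitHoms F T).obj X → T) :=
  fun _ _ h => orbitHoms.ext h

theorem orbitHoms.eval_comp {G : Type u} [Group G] {F : SubgroupFamily G} {T T' : Type u}
    [MulAction G T] [MulAction G T'] {X : (OrbitCat F)ᵒᵖ} (t : T →[G] T')
    (p : (orbitHoms F T).obj X) : orbitHoms.eval (orbitHoms.comp t p) = t (orbitHoms.eval p) := rfl

/-- A `G`-map out of `G/H` may send the base coset to any point fixed by `H`. -/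
theorem orbitHoms.exists_eval_eq_iff {G : Type u} [Group G] {F : SubgroupFamily G} {T : Type u}
    [MulAction G T] {X : (OrbitCat F)ᵒᵖ} (x : T) :
    (∃ p : (orbitHoms F T).obj X, orbitHoms.eval p = x) ↔ ∀ h ∈ X.unop.subgroup, h • x = x := by
  constructor
  · rintro ⟨p, rfl⟩ h hh
    refine (map_smul (show (G ⧸ X.unop.subgroup) →[G] T from p) h _).symm.trans ?_
    have : h • ((1 : G) : G ⧸ X.unop.subgroup) = ((1 : G) : G ⧸ X.unop.subgroup) :=
      QuotientGroup.eq.2 (by simpa using hh)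
    rw [this]
    rfl
  · intro hx
    let p : (G ⧸ X.unop.subgroup) →[G] T :=
      { toFun := _root_.Quotient.lift (fun g : G => g • x) fun a b h => by
          have := hx _ (QuotientGroup.leftRel_apply.1 h)
          change a • x = b • x
          rw [mul_smul] at this
          rw [← this, smul_inv_smul, this]
        map_smul' := fun g y => by
          induction y using QuotientGroup.induction_on with
          | H z => exact mul_smul g z x }
    exact ⟨p, one_smul G x⟩

variable (hG : IsPushout (GrpCat.ofHom φA) (GrpCat.ofHom φB) (GrpCat.ofHom iA) (GrpCat.ofHom iB))
  (hA : iA.comp φA = iC) (hB : iB.comp φB = iC)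

/-- The extension by zero to a `G`-set of a function on the fixed points. -/
noncomputable def orbitHoms.extend {T : Type u} [MulAction G T] {F : SubgroupFamily G}
    {X : (OrbitCat F)ᵒᵖ} {D : Type u} [Zero D] (u : (orbitHoms F T).obj X → D) : T → D :=
  Function.extend orbitHoms.eval u 0

theorem orbitHoms.extend_eval {T : Type u} [MulAction G T] {F : SubgroupFamily G}
    {X : (OrbitCat F)ᵒᵖ} {D : Type u} [Zero D] (u : (orbitHoms F T).obj X → D)
    (p : (orbitHoms F T).obj X) : orbitHoms.extend u (orbitHoms.eval p) = u p :=
  orbitHoms.eval_injective.extend_apply _ _ _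

include hG in
-- Splitting the function that sends a fixed edge to its basis element, and every other edge to
-- zero, yields a retraction of the boundary map.
theorem permMod.eq_zero_of_map_eq_zero (X : (OrbitCat F)ᵒᵖ) (z : (permMod F (G ⧸ iC.range)).obj X)
    (h₁ : (permMod.map F (cosetProj (MonoidHom.range_le_of_comp_eq hA))).app X z = 0)
    (h₂ : (permMod.map F (cosetProj (MonoidHom.range_le_of_comp_eq hB))).app X z = 0) : z = 0 := by
  obtain ⟨a, b, hab⟩ := hG.exists_coset_sub hA hB
    (orbitHoms.extend (permMod.of : (orbitHoms F (G ⧸ iC.range)).obj X → _))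
  let a' : (permMod F (G ⧸ iA.range)).obj X →+ (permMod F (G ⧸ iC.range)).obj X :=
    permMod.lift fun p => a (orbitHoms.eval p)
  let b' : (permMod F (G ⧸ iB.range)).obj X →+ (permMod F (G ⧸ iC.range)).obj X :=
    permMod.lift fun p => b (orbitHoms.eval p)
  have key : (a'.comp ((permMod.map F (cosetProj (MonoidHom.range_le_of_comp_eq hA))).app X).hom -
      b'.comp ((permMod.map F (cosetProj (MonoidHom.range_le_of_comp_eq hB))).app X).hom :
        (permMod F (G ⧸ iC.range)).obj X →+ (permMod F (G ⧸ iC.range)).obj X) =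
      AddMonoidHom.id _ := by
    refine permMod.addMonoidHom_ext fun p => ?_
    have := hab (orbitHoms.eval p)
    rw [orbitHoms.extend_eval] at this
    change a' ((permMod.map F _).app X (permMod.of p)) -
      b' ((permMod.map F _).app X (permMod.of p)) = permMod.of p
    rw [permMod.map_app_of, permMod.map_app_of, permMod.lift_of, permMod.lift_of, this]
    rfl
  have hz := DFunLike.congr_fun key z
  change a' ((permMod.map F _).app X z) - b' ((permMod.map F _).app X z) = z at hz
  rw [← hz, h₁, h₂, map_zero, map_zero, sub_zero]

include hG in
theorem permMod.exists_map_eq_of_aug_add_eq_zero (X : (OrbitCat F)ᵒᵖ)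
    (a : (permMod F (G ⧸ iA.range)).obj X) (b : (permMod F (G ⧸ iB.range)).obj X)
    (h : (permMod.aug F (G ⧸ iA.range)).app X a + (permMod.aug F (G ⧸ iB.range)).app X b = 0) :
    ∃ z, (permMod.map F (cosetProj (MonoidHom.range_le_of_comp_eq hA))).app X z = a ∧
      -(permMod.map F (cosetProj (MonoidHom.range_le_of_comp_eq hB))).app X z = b := by
  let PA : Type u := (permMod F (G ⧸ iA.range)).obj X
  let PB : Type u := (permMod F (G ⧸ iB.range)).obj X
  let PC : Type u := (permMod F (G ⧸ iC.range)).obj X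
  let qA : PC →+ PA := ((permMod.map F (cosetProj (MonoidHom.range_le_of_comp_eq hA))).app X).hom
  let qB : PC →+ PB := ((permMod.map F (cosetProj (MonoidHom.range_le_of_comp_eq hB))).app X).hom
  -- Work in the cokernel of the boundary and show that all fixed vertices have the same class `q`
  -- there. The quotient map then factors through the augmentation, so it kills chains of
  -- augmentation zero.
  let d : PC →+ PA × PB := qA.prod (-qB)
  let π : PA × PB →+ (PA × PB) ⧸ d.range := QuotientAddGroup.mk' d.range
  have hd (z : PC) : π (qA z, 0) = π (0, qB z) := by
    rw [← sub_eq_zero, ← map_sub]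
    refine (QuotientAddGroup.eq_zero_iff _).2 ⟨z, ?_⟩
    simp [d]
  let f : (G ⧸ iA.range) ⊕ (G ⧸ iB.range) → (PA × PB) ⧸ d.range :=
    Sum.elim (orbitHoms.extend fun p : (orbitHoms F (G ⧸ iA.range)).obj X => π (permMod.of p, 0))
      (orbitHoms.extend fun p : (orbitHoms F (G ⧸ iB.range)).obj X => π (0, permMod.of p))
  have hfA (p : (orbitHoms F (G ⧸ iA.range)).obj X) :
      f (Sum.inl (orbitHoms.eval p)) = π (permMod.of p, 0) :=
    orbitHoms.extend_eval _ _
  have hfB (p : (orbitHoms F (G ⧸ iB.range)).obj X) :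
      f (Sum.inr (orbitHoms.eval p)) = π (0, permMod.of p) :=
    orbitHoms.extend_eval _ _
  have hconn := fun v w => hG.coset_fixed_connected hA hB X.unop.subgroup f (fun e he => by
    obtain ⟨p, rfl⟩ := (orbitHoms.exists_eval_eq_iff e).2 he
    rw [← orbitHoms.eval_comp, ← orbitHoms.eval_comp, hfA, hfB, ← permMod.map_app_of,
      ← permMod.map_app_of]
    exact hd (permMod.of p)) (v := v) (w := w)
  have hvA (p : (orbitHoms F (G ⧸ iA.range)).obj X) (h : G) (hh : h ∈ X.unop.subgroup) :
      h • (Sum.inl (orbitHoms.eval p) : (G ⧸ iA.range) ⊕ (G ⧸ iB.range)) =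
        Sum.inl (orbitHoms.eval p) :=
    congrArg Sum.inl ((orbitHoms.exists_eval_eq_iff _).1 ⟨p, rfl⟩ h hh)
  have hvB (p : (orbitHoms F (G ⧸ iB.range)).obj X) (h : G) (hh : h ∈ X.unop.subgroup) :
      h • (Sum.inr (orbitHoms.eval p) : (G ⧸ iA.range) ⊕ (G ⧸ iB.range)) =
        Sum.inr (orbitHoms.eval p) :=
    congrArg Sum.inr ((orbitHoms.exists_eval_eq_iff _).1 ⟨p, rfl⟩ h hh)
  -- Constancy on fixed vertices is the connectedness of the fixed subgraph. With no fixed vertex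
  -- any `q` will do, so nonemptiness is not needed for exactness in the middle.
  obtain ⟨q, hqA, hqB⟩ : ∃ q, (∀ p : (orbitHoms F (G ⧸ iA.range)).obj X,
      π (permMod.of p, 0) = q) ∧ ∀ p : (orbitHoms F (G ⧸ iB.range)).obj X,
        π (0, permMod.of p) = q := by
    by_cases hne : Nonempty ((orbitHoms F (G ⧸ iA.range)).obj X)
    · obtain ⟨p₀⟩ := hne
      refine ⟨f (Sum.inl (orbitHoms.eval p₀)), fun p => ?_, fun p => ?_⟩
      · rw [← hfA]
        exact hconn _ _ (hvA p) (hvA p₀)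
      · rw [← hfB]
        exact hconn _ _ (hvB p) (hvA p₀)
    · by_cases hne' : Nonempty ((orbitHoms F (G ⧸ iB.range)).obj X)
      · obtain ⟨p₀⟩ := hne'
        refine ⟨f (Sum.inr (orbitHoms.eval p₀)), fun p => (hne ⟨p⟩).elim, fun p => ?_⟩
        rw [← hfB]
        exact hconn _ _ (hvB p) (hvB p₀)
      · exact ⟨0, fun p => (hne ⟨p⟩).elim, fun p => (hne' ⟨p⟩).elim⟩
  let m : ULift.{u} ℤ →+ (PA × PB) ⧸ d.range :=
    (zmultiplesHom _ q).comp AddEquiv.ulift.toAddMonoidHom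
  have hm : m ⟨1⟩ = q := one_zsmul q
  have keyA : (π.comp (AddMonoidHom.inl PA PB) : PA →+ _) =
      m.comp ((permMod.aug F (G ⧸ iA.range)).app X).hom :=
    permMod.addMonoidHom_ext fun p => (hqA p).trans
      (hm.symm.trans (congrArg m (permMod.aug_app_of X p).symm))
  have keyB : (π.comp (AddMonoidHom.inr PA PB) : PB →+ _) =
      m.comp ((permMod.aug F (G ⧸ iB.range)).app X).hom :=
    permMod.addMonoidHom_ext fun p => (hqB p).trans
      (hm.symm.trans (congrArg m (permMod.aug_app_of X p).symm))
  have hab : π (a, b) = 0 := by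
    have h1 : ((a, b) : PA × PB) = AddMonoidHom.inl PA PB a + AddMonoidHom.inr PA PB b := by simp
    rw [h1, map_add]
    refine (congrArg₂ (· + ·) (DFunLike.congr_fun keyA a) (DFunLike.congr_fun keyB b)).trans ?_
    refine (map_add m _ _).symm.trans ?_
    exact (congrArg m h).trans (map_zero m)
  obtain ⟨z, hz⟩ := (QuotientAddGroup.eq_zero_iff _).1 hab
  exact ⟨z, congrArg Prod.fst hz, congrArg Prod.snd hz⟩

/-- The coset of `g` is fixed by the conjugate by `g` of the image. The hypothesis on the family
enters only here, to make the augmentation surjective. -/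
theorem orbitHoms.nonempty_of_le_conj {S : Type u} [Group S] (f : S →* G) (X : (OrbitCat F)ᵒᵖ)
    (g : G) (h : X.unop.subgroup ≤ f.range.map (MulAut.conj g).toMonoidHom) :
    Nonempty ((orbitHoms F (G ⧸ f.range)).obj X) := by
  have : ∀ x ∈ X.unop.subgroup, x • (g : G ⧸ f.range) = g := fun x hx => by
    obtain ⟨y, hy, rfl⟩ := h hx
    refine QuotientGroup.eq.2 ?_
    simpa using f.range.inv_mem hy
  exact ((orbitHoms.exists_eval_eq_iff _).2 this).nonempty

theorem permMod.exists_aug_eq {T : Type u} [MulAction G T] {X : (OrbitCat F)ᵒᵖ}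
    (p : (orbitHoms F T).obj X) (r : (trivialMod F).obj X) :
    ∃ a, (permMod.aug F T).app X a = r := by
  refine ⟨(show ULift.{u} ℤ from r).down • permMod.of p, ?_⟩
  rw [map_zsmul, permMod.aug_app_of]
  refine ULift.ext _ _ ?_
  exact (zsmul_one (show ULift.{u} ℤ from r).down).trans (Int.cast_id)

open Limits in
include hG in
/-- The augmented cellular chain complex of the fixed points of the Bass-Serre tree. -/
theorem permMod.shortExact
    (hF : ∀ H ∈ F, ∃ g : G, H ≤ iA.range.map (MulAut.conj g).toMonoidHom ∨
      H ≤ iB.range.map (MulAut.conj g).toMonoidHom) :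
    ∃ h : biprod.lift (permMod.map F (cosetProj (MonoidHom.range_le_of_comp_eq hA)))
        (-permMod.map F (cosetProj (MonoidHom.range_le_of_comp_eq hB))) ≫
          biprod.desc (permMod.aug F (G ⧸ iA.range)) (permMod.aug F (G ⧸ iB.range)) = 0,
      (ShortComplex.mk _ _ h).ShortExact := by
  have haug {T T' : Type u} [MulAction G T] [MulAction G T'] (t : T →[G] T') :
      permMod.map F t ≫ permMod.aug F T' = permMod.aug F T :=
    permMod.hom_ext fun X p => by
      refine (congrArg ((permMod.aug F T').app X) (permMod.map_app_of t X p)).trans ?_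
      exact (permMod.aug_app_of X _).trans (permMod.aug_app_of X p).symm
  refine ⟨by simp [haug], shortExact_biprod_of_apply _ _ _ _ _
    (permMod.eq_zero_of_map_eq_zero F hG hA hB)
    (permMod.exists_map_eq_of_aug_add_eq_zero F hG hA hB) fun X r => ?_⟩
  obtain ⟨g, hg | hg⟩ := hF _ X.unop.mem
  · obtain ⟨p⟩ := orbitHoms.nonempty_of_le_conj F iA X g hg
    obtain ⟨a, ha⟩ := permMod.exists_aug_eq F p r
    exact ⟨a, 0, by rw [map_zero, add_zero, ha]⟩
  · obtain ⟨p⟩ := orbitHoms.nonempty_of_le_conj F iB X g hg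
    obtain ⟨b, hb⟩ := permMod.exists_aug_eq F p r
    exact ⟨0, b, by rw [map_zero, zero_add, hb]⟩

end Exactness

/-! ### Shapiro isomorphism and restriction maps -/

section Comparison

variable {S T G : Type u} [Group S] [Group T] [Group G] (F : SubgroupFamily G)

/-- The comparison map `Ext^n(ℤ[G/f(S)^?], M) → H^n_{F ∩ S}(S, Res M)`. -/
noncomputable def extPermMod (f : S →* G) (M : BredonMod F) (n : ℕ) :
    Abelian.Ext.{u} (permMod F (G ⧸ f.range)) M n →+
      BredonCohomology (F.restrict f) (F.res f M) n :=
  ((Abelian.Ext.mk₀ (trivialUnit F f)).precomp _ (zero_add n)).comp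
    ((resFunctor f (F.map_mem f)).mapExtAddHom _ M n)

theorem extPermMod_bijective {f : S →* G} (hf : Function.Injective f) (M : BredonMod F) (n : ℕ) :
    Function.Bijective (extPermMod F f M n) := by
  have := resFunctor_preservesInjectiveObjects F hf
  exact (resFunctor f (F.map_mem f)).precomp_mapExt_bijective _ (trivialUnit_bijective F hf) M n

theorem trivialUnit_res_aug (f : S →* G) :
    trivialUnit F f ≫ (resFunctor f (F.map_mem f)).map (permMod.aug F (G ⧸ f.range)) =
      (resTrivial f (F.map_mem f)).hom :=
  trivialMod_hom_ext fun X =>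
    (congrArg ((permMod.aug F (G ⧸ f.range)).app _) (trivialUnit_app_one F f X)).trans
      (permMod.aug_app_of _ _)

theorem extPermMod_aug (f : S →* G) (M : BredonMod F) (n : ℕ) (x : BredonCohomology F M n) :
    extPermMod F f M n
      ((Abelian.Ext.mk₀ (permMod.aug F (G ⧸ f.range))).comp x (zero_add n)) =
        resMap F f M n x := by
  change (Abelian.Ext.mk₀ (trivialUnit F f)).comp
    (((Abelian.Ext.mk₀ (permMod.aug F (G ⧸ f.range))).comp x (zero_add n)).mapExactFunctor
      (resFunctor f (F.map_mem f))) (zero_add n) =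
    (Abelian.Ext.mk₀ (resTrivial f (F.map_mem f)).hom).comp
      (x.mapExactFunctor (resFunctor f (F.map_mem f))) (zero_add n)
  rw [Abelian.Ext.mapExactFunctor_comp, Abelian.Ext.mapExactFunctor_mk₀,
    Abelian.Ext.mk₀_comp_mk₀_assoc, trivialUnit_res_aug]

variable (j : S →* T) (g : T →* G) (f : S →* G) (hf : g.comp j = f)

/-- Transitivity of restriction, as a natural transformation. -/
def resCompNatTrans :
    resFunctor g (F.map_mem g) ⋙ resFunctor j (F.map_mem_restrict j g f hf) ⟶
      resFunctor f (F.map_mem f) where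
  app M := (resComp j g f hf (F.map_mem_restrict j g f hf) (F.map_mem g) (F.map_mem f) M).hom
  naturality M N u := by
    ext X : 2
    exact (u.naturality ((orbitFunctorComp j g f hf (F.map_mem_restrict j g f hf) (F.map_mem g)
      (F.map_mem f)).hom.app X.unop).op).symm

/-- On an orbit `S/K`, both sides send `1` to the basis element of the projection `G/f(K) → G/g(T)`.
-/
theorem trivialUnit_res_cosetProj :
    ((resTrivial j (F.map_mem_restrict j g f hf)).hom ≫
      (resFunctor j (F.map_mem_restrict j g f hf)).map (trivialUnit F g)) ≫
        (resCompNatTrans F j g f hf).app (permMod F (G ⧸ g.range)) =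
    trivialUnit F f ≫ (resFunctor f (F.map_mem f)).map
      (permMod.map F (cosetProj (MonoidHom.range_le_of_comp_eq hf))) := by
  refine trivialMod_hom_ext fun X => ?_
  have h1 := congrArg (((resCompNatTrans F j g f hf).app (permMod F (G ⧸ g.range))).app X)
    (trivialUnit_app_one F g (.op ((orbitFunctor j (F.map_mem_restrict j g f hf)).obj X.unop)))
  have h2 := congrArg ((permMod.map F (cosetProj (MonoidHom.range_le_of_comp_eq hf))).app _)
    (trivialUnit_app_one F f X)
  refine Eq.trans h1 (Eq.trans ?_ h2.symm)
  refine (permMod.map_of _ _).trans (Eq.trans ?_ (permMod.map_app_of _ _ _).symm)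
  refine congrArg permMod.of (MulActionHom.ext fun x => ?_)
  induction x using QuotientGroup.induction_on with
  | H z => rfl

theorem extPermMod_cosetProj (M : BredonMod F) (n : ℕ)
    (y : Abelian.Ext.{u} (permMod F (G ⧸ g.range)) M n) :
    extPermMod F f M n ((Abelian.Ext.mk₀
      (permMod.map F (cosetProj (MonoidHom.range_le_of_comp_eq hf)))).comp y (zero_add n)) =
        resMapSubgroup F j g f hf M n (extPermMod F g M n y) := by
  let Rg := resFunctor g (F.map_mem g)
  let Rj := resFunctor j (F.map_mem_restrict j g f hf)
  let Rf := resFunctor f (F.map_mem f)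
  let τ : Rg ⋙ Rj ⟶ Rf := resCompNatTrans F j g f hf
  change (Abelian.Ext.mk₀ (trivialUnit F f)).comp (((Abelian.Ext.mk₀ (permMod.map F
      (cosetProj (MonoidHom.range_le_of_comp_eq hf)))).comp y (zero_add n)).mapExactFunctor Rf)
        (zero_add n) =
    ((Abelian.Ext.mk₀ (resTrivial j (F.map_mem_restrict j g f hf)).hom).comp
      (((Abelian.Ext.mk₀ (trivialUnit F g)).comp (y.mapExactFunctor Rg)
        (zero_add n)).mapExactFunctor Rj) (zero_add n)).comp
      (Abelian.Ext.mk₀ (τ.app M)) (add_zero n)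
  -- Restricting in two steps agrees on `Ext` with restricting at once, up to the transitivity
  -- isomorphism `τ`, by naturality in the exact functor.
  have hcomp : ((y.mapExactFunctor Rg).mapExactFunctor Rj).comp (Abelian.Ext.mk₀ (τ.app M))
      (add_zero n) = (Abelian.Ext.mk₀ (τ.app _)).comp (y.mapExactFunctor Rf) (zero_add n) := by
    rw [← Abelian.Ext.mapExactFunctor_natTrans τ y, Abelian.Ext.mapExactFunctor_functor_comp]
  rw [Abelian.Ext.mapExactFunctor_comp, Abelian.Ext.mapExactFunctor_mk₀,
    Abelian.Ext.mk₀_comp_mk₀_assoc, ← trivialUnit_res_cosetProj, Abelian.Ext.mapExactFunctor_comp,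
    Abelian.Ext.mapExactFunctor_mk₀, Abelian.Ext.mk₀_comp_mk₀_assoc,
    Abelian.Ext.comp_assoc_of_third_deg_zero, hcomp, Abelian.Ext.mk₀_comp_mk₀_assoc]

end Comparison

/-! ### The Mayer–Vietoris sequence -/

theorem corollary4p7
    {A B C G : Type u} [Group A] [Group B] [Group C] [Group G]
    (φA : C →* A) (φB : C →* B) (hφA : Function.Injective φA) (hφB : Function.Injective φB)
    (iA : A →* G) (iB : B →* G) (iC : C →* G) (hA : iA.comp φA = iC) (hB : iB.comp φB = iC)
    (hG : IsPushout (GrpCat.ofHom φA) (GrpCat.ofHom φB) (GrpCat.ofHom iA) (GrpCat.ofHom iB))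
    (F : SubgroupFamily G)
    (hF : ∀ H ∈ F, ∃ g : G, H ≤ iA.range.map (MulAut.conj g).toMonoidHom ∨
      H ≤ iB.range.map (MulAut.conj g).toMonoidHom)
    (M : BredonMod F) :
    ∃ δ : ∀ n : ℕ, BredonCohomology (F.restrict iC) (F.res iC M) n →+
        BredonCohomology F M (n + 1),
      Function.Injective (mvRes F iA iB M 0) ∧
        ∀ n : ℕ,
          Function.Exact (mvRes F iA iB M n) (mvDiff F φA φB iA iB iC hA hB M n) ∧
          Function.Exact (mvDiff F φA φB iA iB iC hA hB M n) (δ n) ∧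
          Function.Exact (δ n) (mvRes F iA iB M (n + 1)) := by
  obtain ⟨hinjA, hinjB⟩ := hG.group_injective hφA hφB
  have hinjC : Function.Injective iC := by
    rw [← hA]
    exact hinjA.comp hφA
  obtain ⟨h, hS⟩ := permMod.shortExact F hG hA hB hF
  obtain ⟨hinj, hexact⟩ := Abelian.Ext.mayerVietoris _ _ _ _ h hS M
  let eA (n : ℕ) := AddEquiv.ofBijective (extPermMod F iA M n) (extPermMod_bijective F hinjA M n)
  let eB (n : ℕ) := AddEquiv.ofBijective (extPermMod F iB M n) (extPermMod_bijective F hinjB M n)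
  let eC (n : ℕ) := AddEquiv.ofBijective (extPermMod F iC M n) (extPermMod_bijective F hinjC M n)
  let e (n : ℕ) := (eA n).prodCongr (eB n)
  have hα (n : ℕ) (x : BredonCohomology F M n) : mvRes F iA iB M n x = e n
      ((Abelian.Ext.mk₀ (permMod.aug F (G ⧸ iA.range))).comp x (zero_add n),
        (Abelian.Ext.mk₀ (permMod.aug F (G ⧸ iB.range))).comp x (zero_add n)) :=
    Prod.ext (extPermMod_aug F iA M n x).symm (extPermMod_aug F iB M n x).symm
  have hβ (n : ℕ) (y) : mvDiff F φA φB iA iB iC hA hB M n (e n y) = eC n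
      ((Abelian.Ext.mk₀ (permMod.map F (cosetProj (MonoidHom.range_le_of_comp_eq hA)))).comp y.1
        (zero_add n) -
      (Abelian.Ext.mk₀ (permMod.map F (cosetProj (MonoidHom.range_le_of_comp_eq hB)))).comp y.2
        (zero_add n)) := by
    rw [map_sub]
    exact congrArg₂ (· - ·) (extPermMod_cosetProj F φA iA iC hA M n y.1).symm
      (extPermMod_cosetProj F φB iB iC hB M n y.2).symm
  -- The connecting map needs transport only at its source: its target `Ext^(n+1)(ℤ, M)` is by
  -- definition the Bredon cohomology of `G`.
  refine ⟨fun n => (hS.extClass.precomp M (add_comm 1 n)).comp (eC n).symm.toAddMonoidHom,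
    fun x y hxy => ?_, fun n => ⟨fun y => ?_, fun z => ?_, fun x => ?_⟩⟩
  · rw [hα, hα] at hxy
    exact hinj ((e 0).injective hxy)
  · obtain ⟨y, rfl⟩ := (e n).surjective y
    rw [hβ, map_eq_zero_iff _ (eC n).injective]
    refine ((hexact n).1 y).trans (exists_congr fun x => ?_)
    rw [hα, (e n).injective.eq_iff]
    rfl
  · obtain ⟨z, rfl⟩ := (eC n).surjective z
    change hS.extClass.precomp M (add_comm 1 n) ((eC n).symm (eC n z)) = 0 ↔ _
    rw [AddEquiv.symm_apply_apply]
    refine ((hexact n).2.1 z).trans ⟨?_, ?_⟩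
    · rintro ⟨y, rfl⟩
      exact ⟨e n y, hβ n y⟩
    · rintro ⟨y, hy⟩
      obtain ⟨y, rfl⟩ := (e n).surjective y
      rw [hβ] at hy
      exact ⟨y, (eC n).injective hy⟩
  · rw [hα, map_eq_zero_iff _ (e (n + 1)).injective]
    refine ((hexact n).2.2 x).trans ⟨?_, ?_⟩
    · rintro ⟨z, rfl⟩
      exact ⟨eC n z, congrArg (hS.extClass.precomp M (add_comm 1 n))
        ((eC n).symm_apply_apply z)⟩
    · rintro ⟨z, rfl⟩
      exact ⟨(eC n).symm z, rfl⟩
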